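/- Let $\mathbb K$ be a subfield of $\mathbb R$ and $I\subseteq\mathbb R$ an interval with $\inf I=0$. Put $W_n(\mathbb K)=\{\lambda\in\mathbb K^n:\lambda_i\ge 0,\ \sum_i\lambda_i>0\}$. A $\mathbb K$-weighted mean on $I$ is a function $\mathscr M\colon\bigcup_{n\ge1} I^n\times W_n(\mathbb K)\to I$ such that: (i) $\mathscr M(x,t\lambda)=\mathscr M(x,\lambda)$ for $t\in\mathbb K$, $t>0$; (ii) $\mathscr M(x,\lambda+\mu)=\mathscr M((x_1,x_1,\dots,x_n,x_n),(\lambda_1,\mu_1,\dots,\lambda_n,\mu_n))$ for $\lambda,\mu\in W_n(\mathbb K)$; (iii) $\min_i x_i\le\mathscr M(x,\lambda)\le\max_i x_i$; (iv) an entry of weight $0$ can be dropped together with its weight. It is symmetric if it is invariant under simultaneous permutations of entries and weights, monotone if it is nondecreasing in each entry, and continuous in entries if $\mathscr M(\cdot,\lambda)$ is continuous on $I^n$ for all $n$ and $\lambda\in W_n(\mathbb K)$. Its Hardy constant $\mathrm{Hc}(\mathscr M)$ is the smallest $C\in[0,\infty]$ (namely $\infty$ if no finite $C$ works) with $$\sum_{n=1}^\infty\lambda_n\,\mathscr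 M\big((x_1,\dots,x_n),(\lambda_1,\dots,\lambda_n)\big)\le C\sum_{n=1}^\infty\lambda_nx_n$$ for all sequences of positive elements $x_n\in I$ and $\lambda_n\in\mathbb K$. A function $g\colon[0,1)\to I$ is $\mathbb K$-simple if there are $0=s_0<s_1<\dots<s_n=1$ in $\mathbb K$ such that $g$ is constant, equal to some $y_i$, on each $[s_{i-1},s_i)$; put $\mathscr M g(x)\,dx=\mathscr M\big((y_1,\dots,y_n),(s_1-s_0,\dots,s_n-s_{n-1})\big)$. For $f\colon[0,1)\to I$ let $\mathrm{RG}(f)$ be the smallest closed interval containing the range of $f$ and, for $\varepsilon>0$, let $B_\varepsilon(f)$ be the set of $\mathbb K$-simple $g\colon[0,1)\to I$ with $|\mathrm{RG}(g)\setminus\mathrm{RG}(f)|<\varepsilon$ and $\|f-g\|_1<\varepsilon$, where $|\cdot|$ is Lebesgue measure. For an integrable $f\colon[a,b)\to I$ (with $a<b$) let $\tilde f(u)=f(a+u(b-a))$, $u\in[0,1)$, and $$\mathscr M^L(f)=\lim_{\varepsilon\to0^+}\inf_{g\in B_\varepsilon(\tilde f)}\mathscr M g(x)\,dx,\qquad \mathscr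 M^U(f)=\lim_{\varepsilon\to0^+}\sup_{g\in B_\varepsilon(\tilde f)}\mathscr M g(x)\,dx$$ (values in $[0,\infty]$). Let $\mathscr M^0(f)$ be the common value of $\mathscr M^L(f)$ and $\mathscr M^U(f)$, defined for those $f$ for which they agree. For $\mathfrak N\in\{\mathscr M^L,\mathscr M^U,\mathscr M^0\}$ the integral Hardy constant $\mathrm{iHc}(\mathfrak N)$ is the smallest $C\in[0,\infty]$ (again $\infty$ if no finite $C$ works) with $$\int_0^\infty\mathfrak N\big(f|_{[0,t)}\big)\,dt\le C\int_0^\infty f(t)\,dt$$ for every integrable $f\colon[0,\infty)\to I$ for which $\mathfrak N(f|_{[0,t)})$ is defined for almost every $t>0$ (no restriction for $\mathscr M^L$ and $\mathscr M^U$). Theorem. Let $\mathscr M$ be a symmetric and monotone $\mathbb K$-weighted mean on $I$, where $\inf I=0$. If $I$ has a greatest element, assume also that $\mathscr M$ is continuous in entries. Then $$\mathrm{iHc}(\mathscr M^L)=\mathrm{iHc}(\mathscr M^U)=\mathrm{iHc}(\mathscr M^0)=\mathrm{Hc}(\mathscr M).$$ -/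

import Mathlib

open Set MeasureTheory
open scoped ENNReal

namespace HardyMeans

/-- `W_n(K)`: the `n`-dimensional weight vectors over the field `K`. -/
def IsWeight (K : Subfield ℝ) {n : ℕ} (w : Fin n → ℝ) : Prop :=
  (∀ i, w i ∈ K ∧ 0 ≤ w i) ∧ 0 < ∑ i, w i

/-- The shuffle `(p₁, q₁, p₂, q₂, …, pₙ, qₙ)` of two vectors. -/
def shuffle {n : ℕ} (p q : Fin n → ℝ) : Fin (n * 2) → ℝ :=
  fun k => if k.modNat = 0 then p k.divNat else q k.divNat

/-- A `K`-weighted mean on `I`. The value of `toFun n x w` matters only for `x ∈ Iⁿ` and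
`w ∈ W_n(K)`; note that `W_0(K)` is empty. -/
structure WeightedMean (K : Subfield ℝ) (I : Set ℝ) where
  toFun : (n : ℕ) → (Fin n → ℝ) → (Fin n → ℝ) → ℝ
  mem : ∀ (n : ℕ) (x w : Fin n → ℝ), (∀ i, x i ∈ I) → IsWeight K w → toFun n x w ∈ I
  /-- nullhomogeneity in the weights -/
  nullhomogeneous : ∀ (n : ℕ) (x w : Fin n → ℝ) (t : ℝ), (∀ i, x i ∈ I) → IsWeight K w →
    t ∈ K → 0 < t → toFun n x (fun i => t * w i) = toFun n x w
  /-- reduction principle -/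
  reduction : ∀ (n : ℕ) (x v w : Fin n → ℝ), (∀ i, x i ∈ I) → IsWeight K v → IsWeight K w →
    toFun n x (fun i => v i + w i) = toFun (n * 2) (shuffle x x) (shuffle v w)
  /-- mean value property: the value lies between the least and the greatest entry -/
  mean_value : ∀ (n : ℕ) (x w : Fin n → ℝ), (∀ i, x i ∈ I) → IsWeight K w →
    (∃ i, x i ≤ toFun n x w) ∧ (∃ j, toFun n x w ≤ x j)
  /-- elimination principle: an entry of weight zero can be dropped -/
  elimination : ∀ (n : ℕ) (x w : Fin (n + 1) → ℝ) (j : Fin (n + 1)), (∀ i, x i ∈ I) →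
    IsWeight K w → w j = 0 →
    toFun (n + 1) x w = toFun n (fun i => x (j.succAbove i)) (fun i => w (j.succAbove i))

variable {K : Subfield ℝ} {I : Set ℝ}

namespace WeightedMean

/-- The mean is invariant under simultaneous permutations of entries and weights. -/
def IsSymmetric (M : WeightedMean K I) : Prop :=
  ∀ (n : ℕ) (x w : Fin n → ℝ) (σ : Equiv.Perm (Fin n)), (∀ i, x i ∈ I) → IsWeight K w →
    M.toFun n (x ∘ σ) (w ∘ σ) = M.toFun n x w

/-- The mean is nondecreasing in each of its entries. -/
def IsMonotone (M : WeightedMean K I) : Prop :=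
  ∀ (n : ℕ) (x y w : Fin n → ℝ), (∀ i, x i ∈ I) → (∀ i, y i ∈ I) → IsWeight K w →
    (∀ i, x i ≤ y i) → M.toFun n x w ≤ M.toFun n y w

/-- For every fixed weight vector the mean is continuous on `Iⁿ`. -/
def IsContinuousInEntries (M : WeightedMean K I) : Prop :=
  ∀ (n : ℕ) (w : Fin n → ℝ), IsWeight K w →
    ContinuousOn (fun x => M.toFun n x w) {x : Fin n → ℝ | ∀ i, x i ∈ I}

/-- The (weighted, discrete) Hardy constant `Hc(M)`: the smallest `C ∈ [0, ∞]` with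
`∑ wₙ M((x₁,…,xₙ),(w₁,…,wₙ)) ≤ C ∑ wₙ xₙ` for all sequences of positive elements `xₙ` of `I` and
`wₙ` of `K` (indexed from `0` here). It is `∞` when no finite `C` works. -/
noncomputable def hardyConst (M : WeightedMean K I) : ℝ≥0∞ :=
  sInf {C : ℝ≥0∞ | ∀ x w : ℕ → ℝ, (∀ n, x n ∈ I ∧ 0 < x n) → (∀ n, w n ∈ K ∧ 0 < w n) →
    ∑' n, ENNReal.ofReal
        (w n * M.toFun (n + 1) (fun i : Fin (n + 1) => x i) (fun i : Fin (n + 1) => w i))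
      ≤ C * ∑' n, ENNReal.ofReal (w n * x n)}

end WeightedMean

/-- A `K`-simple function `[0,1) → I`, given by division points `0 = s₀ < s₁ < … < sₙ = 1` in `K`
and by its values `yᵢ ∈ I` on the intervals `[sᵢ, sᵢ₊₁)`. -/
structure SimpleFn (K : Subfield ℝ) (I : Set ℝ) where
  n : ℕ
  s : Fin (n + 1) → ℝ
  y : Fin n → ℝ
  s_mem : ∀ i, s i ∈ K
  s_strictMono : StrictMono s
  s_zero : s 0 = 0
  s_last : s (Fin.last n) = 1
  y_mem : ∀ i, y i ∈ I

/-- The function itself (extended by `0` outside `[0,1)`). -/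
noncomputable def SimpleFn.toFun (g : SimpleFn K I) (u : ℝ) : ℝ :=
  ∑ i, (Ico (g.s i.castSucc) (g.s i.succ)).indicator (fun _ => g.y i) u

/-- The integral-type notation `M g(x) dx` for a `K`-simple function: the mean of the values,
weighted by the lengths of the intervals. By the axioms of a weighted mean it does not depend on
the division that is used to present `g`. -/
def WeightedMean.simple (M : WeightedMean K I) (g : SimpleFn K I) : ℝ :=
  M.toFun g.n g.y (fun i => g.s i.succ - g.s i.castSucc)

/-- The smallest closed interval that contains the range of `f` on `[0,1)`. -/
def rangeHull (f : ℝ → ℝ) : Set ℝ :=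
  closure (convexHull ℝ (f '' Ico 0 1))

/-- `B_ε(f)` for `f : [0,1) → I`: the `K`-simple functions `g : [0,1) → I` whose range hull exceeds
that of `f` by a set of measure less than `ε` and whose `L¹` distance to `f` is less than `ε`. -/
def nhdSimple (K : Subfield ℝ) (I : Set ℝ) (ε : ℝ) (f : ℝ → ℝ) : Set (SimpleFn K I) :=
  {g | volume (rangeHull g.toFun \ rangeHull f) < ENNReal.ofReal ε ∧
    ∫⁻ u in Ico (0 : ℝ) 1, ENNReal.ofReal |f u - g.toFun u| < ENNReal.ofReal ε}

/-- `f|_{[a,b)}` transported to `[0,1)` by the increasing affine bijection. -/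
def rescale (a b : ℝ) (f : ℝ → ℝ) : ℝ → ℝ :=
  fun u => f (a + u * (b - a))

namespace WeightedMean

/-- The lower integral mean `M^L(f|_{[a,b)})`, where `a < b`: the limit as `ε ↓ 0` of the infimum
of `M g(x) dx` over the `g` in `B_ε` of the rescaled function. The infimum grows as `ε` decreases,
so that the limit is the supremum over `ε > 0`. It may be infinite if `f` is unbounded. -/
noncomputable def lower (M : WeightedMean K I) (a b : ℝ) (f : ℝ → ℝ) : EReal :=
  ⨆ ε : {ε : ℝ // 0 < ε}, ⨅ g ∈ nhdSimple K I ε (rescale a b f), (M.simple g : EReal)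

/-- The upper integral mean `M^U(f|_{[a,b)})`, where `a < b`. -/
noncomputable def upper (M : WeightedMean K I) (a b : ℝ) (f : ℝ → ℝ) : EReal :=
  ⨅ ε : {ε : ℝ // 0 < ε}, ⨆ g ∈ nhdSimple K I ε (rescale a b f), (M.simple g : EReal)

/-- `M^0(f|_{[a,b)})` is well-defined. -/
def ExtDefined (M : WeightedMean K I) (a b : ℝ) (f : ℝ → ℝ) : Prop :=
  M.lower a b f = M.upper a b f

/-- `M^0(f|_{[a,b)})`, the common value of the lower and the upper mean where they agree. -/
noncomputable def ext (M : WeightedMean K I) (a b : ℝ) (f : ℝ → ℝ) : EReal :=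
  M.lower a b f

end WeightedMean

/-- The integral Hardy constant of a functional mean `N` on an interval `I ⊆ [0, ∞)` whose domain
is given by `D` (`D a b f` says that `f|_{[a,b)}` belongs to the domain, and then `N a b f` is the
mean of `f|_{[a,b)}`): the smallest `C ∈ [0, ∞]` with
`∫₀^∞ N(f|_{[0,t)}) dt ≤ C ∫₀^∞ f(t) dt` for all integrable `f : [0, ∞) → I` such that
`N(f|_{[0,t)})` is defined for almost every `t > 0`. It is `∞` when no finite `C` works. -/
noncomputable def integralHardyConstOn (I : Set ℝ) (D : ℝ → ℝ → (ℝ → ℝ) → Prop)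
    (N : ℝ → ℝ → (ℝ → ℝ) → EReal) : ℝ≥0∞ :=
  sInf {C : ℝ≥0∞ | ∀ f : ℝ → ℝ, MapsTo f (Ici 0) I → IntegrableOn f (Ici 0) →
    (∀ᵐ t ∂(volume.restrict (Ioi (0 : ℝ))), D 0 t f) →
    ∫⁻ t in Ioi (0 : ℝ), (N 0 t f).toENNReal ≤ C * ∫⁻ t in Ioi (0 : ℝ), ENNReal.ofReal (f t)}

/-- The integral Hardy constant of a functional mean that is defined on all integrable functions
on bounded intervals with values in `I`. -/
noncomputable def integralHardyConst (I : Set ℝ) (N : ℝ → ℝ → (ℝ → ℝ) → EReal) : ℝ≥0∞ :=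
  integralHardyConstOn I (fun _ _ _ => True) N

end HardyMeans

/-! ### Means depend only on the weight distribution -/

namespace HardyMeans

/-! Everything rests on two facts. A symmetric mean depends only on the weight distribution that it
is given (`toFun_eq_distrib`), and if it is also monotone, it is monotone for stochastic dominance
(`toFun_le_of_tailSum_le`). Inequalities between means thus become inequalities between tail
functions, and sums and integrals are computed by layer cake formulas.

The inequality iHc(M^U) ≤ Hc(M): put m(s) = |{f ≥ s}|. A simple function near f on [0,t) has a tail
function that exceeds m/t only by an error of small integral. The supremum of the means of all such
tuples, as the error tends to 0, is nonincreasing in t, so its integral is bounded by Riemann sums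
of step τ. In such a sum choose one tuple for each node (k+1)τ. One nonincreasing sequence on a fine
grid, the envelope, dominates all of them at once: its initial piece of length (k+1)τ dominates the
k-th tuple. Its tail function is essentially the maximum, not the sum, over k of the stretched
tails, hence at most m plus errors. The discrete Hardy inequality for the envelope gives the bound C
∫ m = C ∫ f (`sum_val_le`, `lintegral_majorant_le`).

The inequality iHc(M^0) ≥ Hc(M): replace finitely many terms of a sequence by a continuous
decreasing F that exceeds their decreasing rearrangement with a margin and has nearly the same
integral (`exists_continuous_majorant`). M^0 need not be defined for F, but it is defined on almost
every [0,t) for suitable multiples rF with r close to 1: monotone functions have only countably many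
discontinuities (`exists_extDefined`). The mean of the first n+1 terms then lies below M^0 of rF on
[0,t) for t in the interval belonging to the n-th term. The margin needs room below an element of I;
if terms reach the greatest element, they are truncated and continuity in the entries is used.

The inequalities iHc(M^0) ≤ iHc(M^L) ≤ iHc(M^U) close the circle; the second needs only that the
neighbourhoods B_ε are nonempty. -/

theorem IsWeight.of_comp_injective {n m : ℕ} {w : Fin n → ℝ} (hw : IsWeight K w)
    (e : Fin m → Fin n) (he : Function.Injective e) (h0 : ∀ i, i ∉ Set.range e → w i = 0) :
    IsWeight K (w ∘ e) := by
  refine ⟨fun i => hw.1 (e i), ?_⟩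
  have h1 : ∑ i, w (e i) = ∑ i, w i := by
    rw [← Finset.sum_image (s := Finset.univ) (g := e) (f := w) (fun a _ b _ h => he h)]
    apply Finset.sum_subset (Finset.subset_univ _)
    intro i _ hi
    apply h0
    simpa using hi
  simpa [h1] using hw.2

namespace WeightedMean

variable (M : WeightedMean K I)

/-- Entries of weight zero can be dropped, and the others can be reordered. -/
theorem toFun_comp_injective (hsymm : M.IsSymmetric) {n m : ℕ} (x w : Fin n → ℝ)
    (hx : ∀ i, x i ∈ I) (hw : IsWeight K w) (e : Fin m → Fin n) (he : Function.Injective e)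
    (h0 : ∀ i, i ∉ Set.range e → w i = 0) :
    M.toFun m (x ∘ e) (w ∘ e) = M.toFun n x w := by
  induction n with
  | zero =>
    exfalso
    have := hw.2
    simp at this
  | succ n ih =>
    -- A bijection is a permutation, so symmetry applies. Otherwise a missed index carries weight
    -- zero and can be eliminated.
    by_cases hsur : Function.Surjective e
    · have hcard : m = n + 1 := by
        simpa using Fintype.card_of_bijective ⟨he, hsur⟩
      subst hcard
      exact hsymm _ x w (Equiv.ofBijective e ⟨he, hsur⟩) hx hw
    · simp only [Function.Surjective, not_forall] at hsur
      obtain ⟨j, hj⟩ := hsur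
      have hj' : ∀ k, e k ≠ j := fun k hk => hj ⟨k, hk⟩
      have hwj : w j = 0 := h0 j (by rintro ⟨k, hk⟩; exact hj' k hk)
      choose e' he' using fun k => Fin.exists_succAbove_eq (hj' k)
      have hcomp : e = j.succAbove ∘ e' := funext fun k => (he' k).symm
      rw [M.elimination n x w j hx hw hwj]
      have hinj : Function.Injective e' := by
        intro a b hab
        apply he
        rw [← he' a, ← he' b, hab]
      have hw' : IsWeight K (w ∘ j.succAbove) := by
        refine hw.of_comp_injective _ Fin.succAbove_right_injective ?_
        intro i hi
        simp only [Fin.range_succAbove, mem_compl_iff, mem_singleton_iff, not_not] at hi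
        rw [hi, hwj]
      rw [hcomp]
      refine ih (x ∘ j.succAbove) (w ∘ j.succAbove) (fun i => hx _) hw' e' hinj ?_
      intro i hi
      apply h0
      rintro ⟨k, hk⟩
      rw [← he' k] at hk
      exact hi ⟨k, Fin.succAbove_right_injective hk⟩

/-- Two equal entries can be merged by adding their weights. -/
theorem toFun_merge (hsymm : M.IsSymmetric) {n : ℕ} (x w : Fin (n + 1) → ℝ)
    (hx : ∀ i, x i ∈ I) (hw : IsWeight K w) (hpos : ∀ i, 0 < w i) (b : Fin (n + 1)) (a : Fin n)
    (hab : x (b.succAbove a) = x b) :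
    M.toFun n (x ∘ b.succAbove) (fun i => w (b.succAbove i) + Pi.single (M := fun _ => ℝ) a (w b) i)
      = M.toFun (n + 1) x w := by
  set v : Fin n → ℝ := w ∘ b.succAbove
  set u : Fin n → ℝ := Pi.single (M := fun _ => ℝ) a (w b)
  have hv : IsWeight K v :=
    ⟨fun i => hw.1 _, Finset.sum_pos (fun i _ => hpos _) ⟨a, Finset.mem_univ _⟩⟩
  have hu : IsWeight K u := by
    constructor
    · intro i
      by_cases h : i = a
      · subst h; simpa [u] using hw.1 b
      · simp [u, h, K.zero_mem]
    · simp only [u, Finset.sum_pi_single', Finset.mem_univ, if_true]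
      exact hpos b
  have hred := M.reduction n (x ∘ b.succAbove) v u (fun i => hx _) hv hu
  have hsh : ∀ (p q : Fin n → ℝ) (l : Fin n) (c : Fin 2),
      shuffle p q (finProdFinEquiv (l, c)) = if c = 0 then p l else q l := by
    intro p q l c
    have h1 := finProdFinEquiv.symm_apply_apply (l, c)
    have h2 : (finProdFinEquiv (l, c)).divNat = l := congrArg Prod.fst h1
    have h3 : (finProdFinEquiv (l, c)).modNat = c := congrArg Prod.snd h1
    simp only [shuffle, h2, h3]
  -- In the shuffle of `v` and `u`, the only slot of the second kind with nonzero weight is the one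
  -- at `a`. Sending `b` there and the other indices to the slots of the first kind recovers `x` and
  -- `w`.
  set e : Fin (n + 1) → Fin (n * 2) :=
    b.insertNth (α := fun _ => Fin (n * 2)) (finProdFinEquiv (a, (1 : Fin 2)))
      (fun l => finProdFinEquiv (l, (0 : Fin 2))) with he
  have heb : e b = finProdFinEquiv (a, (1 : Fin 2)) := by simp [he]
  have hes : ∀ l, e (b.succAbove l) = finProdFinEquiv (l, (0 : Fin 2)) := by simp [he]
  have hinj : Function.Injective e := by
    intro i j hij
    rcases Fin.eq_self_or_eq_succAbove b i with hi | ⟨i', rfl⟩ <;>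
      rcases Fin.eq_self_or_eq_succAbove b j with hj | ⟨j', rfl⟩
    · exact hi.trans hj.symm
    · rw [hi, heb, hes] at hij
      simpa using finProdFinEquiv.injective hij
    · rw [hj, heb, hes] at hij
      simpa using finProdFinEquiv.injective hij
    · rw [hes, hes] at hij
      have := finProdFinEquiv.injective hij
      simp only [Prod.mk.injEq, and_true] at this
      rw [this]
  have hs : IsWeight K (shuffle v u) := by
    constructor
    · intro i
      simp only [shuffle]
      split_ifs
      · exact hv.1 _
      · exact hu.1 _
    · have : ∑ i, shuffle v u i = ∑ i, v i + ∑ i, u i := by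
        rw [← finProdFinEquiv.sum_comp, Fintype.sum_prod_type]
        simp only [hsh, Fin.sum_univ_two, if_true, one_ne_zero, if_false, Finset.sum_add_distrib]
      rw [this]
      exact add_pos hv.2 hu.2
  have hem := M.toFun_comp_injective hsymm (shuffle (x ∘ b.succAbove) (x ∘ b.succAbove))
    (shuffle v u) (by intro i; simp only [shuffle]; split_ifs <;> exact hx _) hs e hinj (by
      intro i hi
      obtain ⟨⟨l, c⟩, rfl⟩ := finProdFinEquiv.surjective i
      rw [hsh]
      split_ifs with hc
      · subst hc
        exact absurd ⟨_, hes l⟩ hi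
      · have hc1 : c = 1 := by omega
        subst hc1
        have hla : l ≠ a := by
          rintro rfl
          exact hi ⟨_, heb⟩
        simp [u, hla])
  have hxe : shuffle (x ∘ b.succAbove) (x ∘ b.succAbove) ∘ e = x := by
    funext i
    rcases Fin.eq_self_or_eq_succAbove b i with hi | ⟨i', rfl⟩
    · simp [hi, heb, hsh, hab]
    · simp [hes, hsh]
  have hwe : shuffle v u ∘ e = w := by
    funext i
    rcases Fin.eq_self_or_eq_succAbove b i with hi | ⟨i', rfl⟩
    · simp [hi, heb, hsh, u]
    · simp [hes, hsh, v]
  rw [hxe, hwe] at hem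
  exact hred.trans hem.symm

/-- The value of the mean at a finitely supported weight distribution on `I`. -/
noncomputable def distrib (μ : ℝ →₀ ℝ) : ℝ :=
  M.toFun μ.support.card (fun i => (μ.support.equivFin.symm i : ℝ))
    (fun i => μ (μ.support.equivFin.symm i : ℝ))

/-- Each zero weight is eliminated and each pair of equal entries is merged, both of which lower
`n`. What remains has distinct entries and positive weights, hence is a reordering of the canonical
list of atoms. -/
theorem toFun_eq_distrib (hsymm : M.IsSymmetric) {n : ℕ} (x w : Fin n → ℝ)
    (hx : ∀ i, x i ∈ I) (hw : IsWeight K w) :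
    M.toFun n x w = M.distrib (∑ i, Finsupp.single (x i) (w i)) := by
  induction n with
  | zero => exact absurd hw.2 (by simp)
  | succ n ih =>
    by_cases hz : ∃ j, w j = 0
    · obtain ⟨j, hj⟩ := hz
      rw [M.elimination n x w j hx hw hj, Fin.sum_univ_succAbove _ j, hj]
      simp only [Finsupp.single_zero, zero_add]
      refine ih _ _ (fun i => hx _) (hw.of_comp_injective _ Fin.succAbove_right_injective ?_)
      intro i hi
      simp only [Fin.range_succAbove, mem_compl_iff, mem_singleton_iff, not_not] at hi
      rw [hi, hj]
    · have hpos : ∀ i, 0 < w i := fun i =>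
        lt_of_le_of_ne (hw.1 i).2 (fun h => hz ⟨i, h.symm⟩)
      by_cases hinj : Function.Injective x
      · set μ : ℝ →₀ ℝ := ∑ i, Finsupp.single (x i) (w i) with hμ
        have hval : ∀ i, μ (x i) = w i := by
          intro i
          rw [hμ, Finsupp.finsetSum_apply, Finset.sum_eq_single i]
          · simp
          · intro j _ hj
            rw [Finsupp.single_apply, if_neg (fun h => hj (hinj h))]
          · simp
        have hsupp : ∀ s, s ∈ μ.support → ∃ i, x i = s := by
          intro s hs
          by_contra hcon
          push Not at hcon
          rw [Finsupp.mem_support_iff] at hs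
          apply hs
          rw [hμ, Finsupp.finsetSum_apply]
          apply Finset.sum_eq_zero
          intro i _
          rw [Finsupp.single_apply, if_neg (hcon i)]
        choose e he using fun i : Fin μ.support.card =>
          hsupp (μ.support.equivFin.symm i) (μ.support.equivFin.symm i).2
        have hxe : (fun i => (μ.support.equivFin.symm i : ℝ)) = x ∘ e :=
          funext fun i => (he i).symm
        have hwe : (fun i => μ (μ.support.equivFin.symm i : ℝ)) = w ∘ e := by
          funext i
          rw [← he i, hval]
          rfl
        rw [distrib, hxe, hwe]
        refine (M.toFun_comp_injective hsymm x w hx hw e ?_ ?_).symm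
        · intro i j hij
          have : (μ.support.equivFin.symm i : ℝ) = μ.support.equivFin.symm j := by
            rw [← he i, ← he j, hij]
          exact μ.support.equivFin.symm.injective (Subtype.ext this)
        · intro i hi
          exfalso
          have hmem : x i ∈ μ.support := by
            rw [Finsupp.mem_support_iff, hval]
            exact (hpos i).ne'
          apply hi
          refine ⟨μ.support.equivFin ⟨x i, hmem⟩, hinj ?_⟩
          rw [he]
          simp
      · simp only [Function.Injective, not_forall] at hinj
        obtain ⟨c, b, hcb, hne⟩ := hinj
        obtain ⟨a, rfl⟩ := Fin.exists_succAbove_eq hne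
        rw [← M.toFun_merge hsymm x w hx hw hpos b a hcb, ih]
        · congr 1
          rw [Fin.sum_univ_succAbove _ b]
          simp only [Function.comp, Finsupp.single_add, Finset.sum_add_distrib]
          rw [add_comm]
          congr 1
          rw [Finset.sum_eq_single a]
          · simp [hcb]
          · intro i _ hi
            simp [hi]
          · simp
        · exact fun i => hx _
        · constructor
          · intro i
            by_cases h : i = a
            · subst h
              simp only [Pi.single_eq_same]
              exact ⟨K.add_mem (hw.1 _).1 (hw.1 _).1, add_nonneg (hw.1 _).2 (hw.1 _).2⟩
            · simpa [h] using hw.1 _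
          · apply Finset.sum_pos _ ⟨a, Finset.mem_univ _⟩
            intro i _
            apply add_pos_of_pos_of_nonneg (hpos _)
            by_cases h : i = a
            · subst h; simpa using (hpos _).le
            · simp [h]

end WeightedMean

/-! ### Quantile coupling and stochastic dominance -/

/-- The total weight of the entries that exceed `s`. -/
noncomputable def tailSum {n : ℕ} (x w : Fin n → ℝ) (s : ℝ) : ℝ :=
  ∑ i, if s < x i then w i else 0

/-- The total weight of the first `k` entries. -/
noncomputable def partialWeight {n : ℕ} (w : Fin n → ℝ) (k : ℕ) : ℝ :=
  ∑ i : Fin n, if (i : ℕ) < k then w i else 0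

section partialWeight

variable {n : ℕ} {w : Fin n → ℝ}

theorem partialWeight_zero : partialWeight w 0 = 0 := by simp [partialWeight]

theorem partialWeight_top : partialWeight w n = ∑ i, w i := by simp [partialWeight]

theorem partialWeight_succ (i : Fin n) :
    partialWeight w (i + 1) = partialWeight w i + w i := by
  have : ∑ j : Fin n, (if j = i then w j else 0) = w i := by simp
  rw [partialWeight, partialWeight, ← this, ← Finset.sum_add_distrib]
  refine Finset.sum_congr rfl fun j _ => ?_
  rcases lt_trichotomy j i with h | h | h
  · have h' : (j : ℕ) < i := h
    simp [h.ne, h', Nat.lt_succ_of_lt h']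
  · simp [h]
  · have h' : (i : ℕ) < j := h
    rw [if_neg (by omega), if_neg (by omega), if_neg h.ne', add_zero]

theorem partialWeight_mem (hw : IsWeight K w) (k : ℕ) : partialWeight w k ∈ K := by
  refine K.sum_mem fun i _ => ?_
  split_ifs
  · exact (hw.1 i).1
  · exact K.zero_mem

theorem partialWeight_mono (hw : IsWeight K w) : Monotone (partialWeight w) := by
  intro k l hkl
  refine Finset.sum_le_sum fun i _ => ?_
  have := (hw.1 i).2
  split_ifs <;> first | omega | simp

theorem partialWeight_nonneg (hw : IsWeight K w) (k : ℕ) : 0 ≤ partialWeight w k := by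
  simpa [partialWeight_zero] using partialWeight_mono hw (Nat.zero_le k)

theorem partialWeight_le (hw : IsWeight K w) {k : ℕ} (hk : k ≤ n) :
    partialWeight w k ≤ ∑ i, w i := by
  simpa [partialWeight_top] using partialWeight_mono hw hk

end partialWeight

/-- Both sides are the length of the intersection of [a, a'] and [b, b']. This makes the coupling
symmetric in its two weight vectors. -/
theorem clamp_sub_clamp_comm {a a' b b' : ℝ} (ha : a ≤ a') (hb : b ≤ b') :
    max a (min a' b') - max a (min a' b) = max b (min b' a') - max b (min b' a) := by
  rcases le_total a b with h1 | h1 <;> rcases le_total a b' with h2 | h2 <;>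
    rcases le_total a' b with h3 | h3 <;> rcases le_total a' b' with h4 | h4 <;>
    simp [*] <;> linarith

theorem sum_sub_telescope (F : ℕ → ℝ) (m : ℕ) :
    ∑ j : Fin m, (F (j + 1) - F j) = F m - F 0 := by
  rw [Fin.sum_univ_eq_sum_range (fun j => F (j + 1) - F j) m, Finset.sum_range_sub]

/-- The quantile coupling of two weight vectors: the length of the intersection of the `i`-th
interval of the first with the `j`-th interval of the second. -/
noncomputable def coupling {n m : ℕ} (v : Fin n → ℝ) (w : Fin m → ℝ) (i : Fin n) (j : Fin m) : ℝ :=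
  max (partialWeight v i) (min (partialWeight v (i + 1)) (partialWeight w (j + 1))) -
    max (partialWeight v i) (min (partialWeight v (i + 1)) (partialWeight w j))

section coupling

variable {n m : ℕ} {v : Fin n → ℝ} {w : Fin m → ℝ}

theorem sum_coupling (hv : IsWeight K v) (h : ∑ i, v i = ∑ j, w j)
    (i : Fin n) : ∑ j, coupling v w i j = v i := by
  simp only [coupling]
  rw [sum_sub_telescope (fun k => max (partialWeight v i)
    (min (partialWeight v (i + 1)) (partialWeight w k))),
    partialWeight_zero, partialWeight_top, ← h]
  have h1 := partialWeight_le hv (Nat.succ_le_of_lt i.2)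
  have h2 := partialWeight_nonneg hv i
  have h3 := partialWeight_nonneg hv (i + 1)
  have h4 := partialWeight_succ (w := v) i
  have h5 := (hv.1 i).2
  rw [min_eq_left h1, min_eq_right h3, max_eq_left h2, max_eq_right (by linarith)]
  linarith

theorem coupling_comm (hv : IsWeight K v) (hw : IsWeight K w) (i : Fin n) (j : Fin m) :
    coupling v w i j = coupling w v j i :=
  clamp_sub_clamp_comm (partialWeight_mono hv (Nat.le_succ _))
    (partialWeight_mono hw (Nat.le_succ _))

theorem coupling_mem (hv : IsWeight K v) (hw : IsWeight K w) (i : Fin n) (j : Fin m) :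
    coupling v w i j ∈ K ∧ 0 ≤ coupling v w i j := by
  constructor
  · have hmax : ∀ a b : ℝ, a ∈ K → b ∈ K → max a b ∈ K := by
      intro a b ha hb; rcases max_choice a b with h | h <;> rw [h] <;> assumption
    have hmin : ∀ a b : ℝ, a ∈ K → b ∈ K → min a b ∈ K := by
      intro a b ha hb; rcases min_choice a b with h | h <;> rw [h] <;> assumption
    have hclamp : ∀ k, max (partialWeight v i)
        (min (partialWeight v (i + 1)) (partialWeight w k)) ∈ K :=
      fun k => hmax _ _ (partialWeight_mem hv _)
        (hmin _ _ (partialWeight_mem hv _) (partialWeight_mem hw k))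
    exact K.sub_mem (hclamp _) (hclamp _)
  · rw [coupling, sub_nonneg]
    have := partialWeight_mono hw (Nat.le_succ j)
    gcongr

/-- When the entries decrease, the `i`-th interval of `v` ends at or before the tail of `x` at level
`y j`, and the tail of `y` at that level ends at or before the `j`-th interval of `w` begins.
Dominance then makes the two intervals disjoint up to an endpoint. -/
theorem coupling_eq_zero (hv : IsWeight K v) (hw : IsWeight K w) {x : Fin n → ℝ}
    {y : Fin m → ℝ} (hx : Antitone x) (hy : Antitone y)
    (hdom : ∀ s, tailSum x v s ≤ tailSum y w s) {i : Fin n} {j : Fin m} (hij : y j < x i) :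
    coupling v w i j = 0 := by
  have h1 : partialWeight v (i + 1) ≤ tailSum x v (y j) := by
    refine Finset.sum_le_sum fun k _ => ?_
    by_cases hk : (k : ℕ) < i + 1
    · have : x i ≤ x k := hx (show k ≤ i from Nat.lt_succ_iff.mp hk)
      rw [if_pos hk, if_pos (hij.trans_le this)]
    · rw [if_neg hk]
      split_ifs
      · exact (hv.1 k).2
      · rfl
  have h2 : tailSum y w (y j) ≤ partialWeight w j := by
    refine Finset.sum_le_sum fun k _ => ?_
    by_cases hk : y j < y k
    · have : (k : ℕ) < j := by
        by_contra hcon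
        exact absurd (hy (show j ≤ k from not_lt.mp hcon)) (not_le.mpr hk)
      rw [if_pos hk, if_pos this]
    · rw [if_neg hk]
      split_ifs
      · exact (hw.1 k).2
      · rfl
  have h3 : partialWeight v (i + 1) ≤ partialWeight w j := h1.trans ((hdom _).trans h2)
  have h4 := partialWeight_mono hw (Nat.le_succ (j : ℕ))
  rw [coupling, min_eq_left h3, min_eq_left (h3.trans h4), sub_self]

end coupling

theorem IsWeight.comp_perm {n : ℕ} {w : Fin n → ℝ} (hw : IsWeight K w) (σ : Equiv.Perm (Fin n)) :
    IsWeight K (w ∘ σ) :=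
  hw.of_comp_injective σ σ.injective fun i hi => absurd (σ.surjective i) hi

theorem tailSum_comp_perm {n : ℕ} (x w : Fin n → ℝ) (σ : Equiv.Perm (Fin n)) (s : ℝ) :
    tailSum (x ∘ σ) (w ∘ σ) s = tailSum x w s :=
  Equiv.sum_comp σ (fun i => if s < x i then w i else 0)

section tailSum

variable {n : ℕ} {x w : Fin n → ℝ}

theorem tailSum_nonneg (hw : ∀ i, 0 ≤ w i) (s : ℝ) : 0 ≤ tailSum x w s := by
  refine Finset.sum_nonneg fun i _ => ?_
  split_ifs
  · exact hw i
  · rfl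

theorem tailSum_le_sum (hw : ∀ i, 0 ≤ w i) (s : ℝ) : tailSum x w s ≤ ∑ i, w i := by
  refine Finset.sum_le_sum fun i _ => ?_
  split_ifs
  · rfl
  · exact hw i

theorem tailSum_antitone (hw : ∀ i, 0 ≤ w i) : Antitone (tailSum x w) := by
  intro s t hst
  refine Finset.sum_le_sum fun i _ => ?_
  by_cases h : t < x i
  · rw [if_pos h, if_pos (hst.trans_lt h)]
  · rw [if_neg h]
    split_ifs
    · exact hw i
    · rfl

end tailSum

namespace WeightedMean

variable (M : WeightedMean K I)

/-- The coupling presents both distributions with common weights indexed by pairs (i, j). On pairs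
of nonzero weight the entries satisfy x i ≤ y j, so entrywise monotonicity applies. -/
theorem toFun_le_of_tailSum_le_of_antitone (hsymm : M.IsSymmetric) (hmono : M.IsMonotone)
    {n m : ℕ} {x v : Fin n → ℝ} {y w : Fin m → ℝ} (hx : ∀ i, x i ∈ I) (hy : ∀ i, y i ∈ I)
    (hv : IsWeight K v) (hw : IsWeight K w) (hsum : ∑ i, v i = ∑ j, w j)
    (hxa : Antitone x) (hya : Antitone y) (hdom : ∀ s, tailSum x v s ≤ tailSum y w s) :
    M.toFun n x v ≤ M.toFun m y w := by
  set E := (finProdFinEquiv (m := n) (n := m)).symm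
  set π : Fin (n * m) → ℝ := fun k => coupling v w (E k).1 (E k).2 with hπ
  set x' : Fin (n * m) → ℝ := fun k => min (x (E k).1) (y (E k).2) with hx'
  set y' : Fin (n * m) → ℝ := fun k => y (E k).2 with hy'
  have hsumE : ∀ {A : Type} [AddCommMonoid A] (F : Fin n → Fin m → A),
      ∑ k, F (E k).1 (E k).2 = ∑ i, ∑ j, F i j := by
    intro A _ F
    rw [← Fintype.sum_prod_type' F, ← E.sum_comp]
  have hsum_w : ∀ j, ∑ i, coupling v w i j = w j := by
    intro j
    simp only [coupling_comm hv hw]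
    exact sum_coupling hw hsum.symm j
  have hπw : IsWeight K π := by
    refine ⟨fun k => coupling_mem hv hw _ _, ?_⟩
    rw [hsumE (fun i j => coupling v w i j)]
    simpa only [sum_coupling hv hsum] using hv.2
  have hx'I : ∀ k, x' k ∈ I := by
    intro k
    rcases min_choice (x (E k).1) (y (E k).2) with h | h <;> simp only [hx', h, hx, hy]
  have h1 : M.toFun n x v = M.toFun (n * m) x' π := by
    rw [M.toFun_eq_distrib hsymm x v hx hv, M.toFun_eq_distrib hsymm x' π hx'I hπw]
    congr 1
    rw [hsumE (fun i j => Finsupp.single (min (x i) (y j)) (coupling v w i j))]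
    refine Finset.sum_congr rfl fun i _ => ?_
    conv_lhs => rw [← sum_coupling hv hsum i]
    rw [Finsupp.single_finsetSum]
    refine Finset.sum_congr rfl fun j _ => ?_
    -- The minimum differs from `x i` only where the coupling vanishes, so using it does not change
    -- the distribution, yet makes the entrywise comparison hold for all pairs.
    by_cases hij : y j < x i
    · simp [coupling_eq_zero hv hw hxa hya hdom hij]
    · rw [min_eq_left (not_lt.mp hij)]
  have h2 : M.toFun m y w = M.toFun (n * m) y' π := by
    rw [M.toFun_eq_distrib hsymm y w hy hw, M.toFun_eq_distrib hsymm y' π (fun k => hy _) hπw]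
    congr 1
    rw [hsumE (fun i j => Finsupp.single (y j) (coupling v w i j)), Finset.sum_comm]
    refine Finset.sum_congr rfl fun j _ => ?_
    conv_lhs => rw [← hsum_w j]
    rw [Finsupp.single_finsetSum]
  rw [h1, h2]
  exact hmono _ _ _ _ hx'I (fun k => hy _) hπw fun k => min_le_right _ _

/-- A symmetric monotone mean is monotone with respect to stochastic dominance. -/
theorem toFun_le_of_tailSum_le (hsymm : M.IsSymmetric) (hmono : M.IsMonotone)
    {n m : ℕ} {x v : Fin n → ℝ} {y w : Fin m → ℝ} (hx : ∀ i, x i ∈ I) (hy : ∀ i, y i ∈ I)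
    (hv : IsWeight K v) (hw : IsWeight K w) (hsum : ∑ i, v i = ∑ j, w j)
    (hdom : ∀ s, tailSum x v s ≤ tailSum y w s) :
    M.toFun n x v ≤ M.toFun m y w := by
  set σ := Tuple.sort (fun i => -x i)
  set ρ := Tuple.sort (fun i => -y i)
  have hσ : Antitone (x ∘ σ) := fun a b hab =>
    neg_le_neg_iff.mp (Tuple.monotone_sort (fun i => -x i) hab)
  have hρ : Antitone (y ∘ ρ) := fun a b hab =>
    neg_le_neg_iff.mp (Tuple.monotone_sort (fun i => -y i) hab)
  rw [← hsymm n x v σ hx hv, ← hsymm m y w ρ hy hw]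
  refine M.toFun_le_of_tailSum_le_of_antitone hsymm hmono (fun i => hx _) (fun i => hy _)
    (hv.comp_perm σ) (hw.comp_perm ρ) ?_ hσ hρ ?_
  · simpa [Function.comp, Equiv.sum_comp] using hsum
  · intro s
    rw [tailSum_comp_perm, tailSum_comp_perm]
    exact hdom s

end WeightedMean

/-! ### Normalized tuples and simple functions -/

/-- A tuple with entries in `I` and with weights in `K` whose sum is `1`. -/
structure WeightedTuple (K : Subfield ℝ) (I : Set ℝ) where
  n : ℕ
  entry : Fin n → ℝ
  weight : Fin n → ℝ
  entry_mem : ∀ i, entry i ∈ I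
  isWeight : IsWeight K weight
  sum_weight : ∑ i, weight i = 1

namespace WeightedTuple

/-- The total weight of the entries that exceed `s`. -/
noncomputable def tail (d : WeightedTuple K I) : ℝ → ℝ := tailSum d.entry d.weight

/-- A weighted tuple with its weights divided by their sum. -/
noncomputable def normalize {n : ℕ} (x w : Fin n → ℝ) (hx : ∀ i, x i ∈ I) (hw : IsWeight K w) :
    WeightedTuple K I where
  n := n
  entry := x
  weight := fun i => (∑ j, w j)⁻¹ * w i
  entry_mem := hx
  isWeight := by
    have hS : ∑ j, w j ∈ K := K.sum_mem fun i _ => (hw.1 i).1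
    refine ⟨fun i => ⟨K.mul_mem (K.inv_mem hS) (hw.1 i).1,
      mul_nonneg (inv_nonneg.mpr hw.2.le) (hw.1 i).2⟩, ?_⟩
    rw [← Finset.mul_sum, inv_mul_cancel₀ hw.2.ne']
    exact one_pos
  sum_weight := by rw [← Finset.mul_sum, inv_mul_cancel₀ hw.2.ne']

theorem tail_normalize {n : ℕ} (x w : Fin n → ℝ) (hx : ∀ i, x i ∈ I) (hw : IsWeight K w) (s : ℝ) :
    (normalize x w hx hw).tail s = (∑ j, w j)⁻¹ * tailSum x w s := by
  simp only [tail, normalize, tailSum, Finset.mul_sum Finset.univ (fun i => ite _ _ _),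
    mul_ite, mul_zero]
  rfl

theorem weight_nonneg (d : WeightedTuple K I) (i : Fin d.n) : 0 ≤ d.weight i :=
  (d.isWeight.1 i).2

theorem tail_nonneg (d : WeightedTuple K I) (s : ℝ) : 0 ≤ d.tail s :=
  tailSum_nonneg d.weight_nonneg s

theorem tail_le_one (d : WeightedTuple K I) (s : ℝ) : d.tail s ≤ 1 :=
  (tailSum_le_sum d.weight_nonneg s).trans_eq d.sum_weight

theorem tail_antitone (d : WeightedTuple K I) : Antitone d.tail :=
  tailSum_antitone d.weight_nonneg

end WeightedTuple

namespace WeightedMean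

variable (M : WeightedMean K I)

/-- The mean of a weighted tuple. -/
def val (d : WeightedTuple K I) : ℝ := M.toFun d.n d.entry d.weight

theorem val_normalize {n : ℕ} (x w : Fin n → ℝ) (hx : ∀ i, x i ∈ I) (hw : IsWeight K w) :
    M.val (WeightedTuple.normalize x w hx hw) = M.toFun n x w :=
  M.nullhomogeneous n x w _ hx hw (K.inv_mem (K.sum_mem fun i _ => (hw.1 i).1))
    (inv_pos.mpr hw.2)

theorem val_mem (d : WeightedTuple K I) : M.val d ∈ I := M.mem _ _ _ d.entry_mem d.isWeight

theorem val_le_val (hsymm : M.IsSymmetric) (hmono : M.IsMonotone) {d d' : WeightedTuple K I}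
    (h : ∀ s, d.tail s ≤ d'.tail s) : M.val d ≤ M.val d' :=
  M.toFun_le_of_tailSum_le hsymm hmono d.entry_mem d'.entry_mem d.isWeight d'.isWeight
    (d.sum_weight.trans d'.sum_weight.symm) h

end WeightedMean

namespace SimpleFn

variable (g : SimpleFn K I)

theorem toFun_eq {u : ℝ} {i : Fin g.n} (hu : u ∈ Ico (g.s i.castSucc) (g.s i.succ)) :
    g.toFun u = g.y i := by
  rw [toFun, Finset.sum_eq_single i]
  · rw [indicator_of_mem hu]
  · intro j _ hj
    apply indicator_of_notMem
    rintro ⟨h1, h2⟩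
    rcases lt_or_gt_of_ne hj with h | h
    · have : g.s j.succ ≤ g.s i.castSucc :=
        g.s_strictMono.monotone (Fin.succ_le_castSucc_iff.mpr h)
      linarith [hu.1]
    · have : g.s i.succ ≤ g.s j.castSucc :=
        g.s_strictMono.monotone (Fin.succ_le_castSucc_iff.mpr h)
      linarith [hu.2]
  · simp

theorem exists_mem_Ico {u : ℝ} (hu : u ∈ Ico (0 : ℝ) 1) :
    ∃ i : Fin g.n, u ∈ Ico (g.s i.castSucc) (g.s i.succ) := by
  obtain ⟨k, hk, hmax⟩ := (Finset.univ.filter fun k => g.s k ≤ u).exists_max_image id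
    ⟨0, by simp [g.s_zero, hu.1]⟩
  simp only [Finset.mem_filter, Finset.mem_univ, true_and, id] at hk hmax
  have hne : k ≠ Fin.last g.n := by
    rintro rfl
    rw [g.s_last] at hk
    exact absurd hu.2 (not_lt.mpr hk)
  obtain ⟨i, rfl⟩ := Fin.exists_castSucc_eq.mpr hne
  refine ⟨i, hk, ?_⟩
  by_contra hcon
  exact absurd (hmax _ (not_lt.mp hcon)) (not_le.mpr (Fin.castSucc_lt_succ))

theorem measurable_toFun : Measurable g.toFun := by
  unfold toFun
  exact Finset.measurable_fun_sum _ fun i _ => measurable_const.indicator measurableSet_Ico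

/-- The values of a simple function with the lengths of the intervals. -/
noncomputable def tuple : WeightedTuple K I where
  n := g.n
  entry := g.y
  weight := fun i => g.s i.succ - g.s i.castSucc
  entry_mem := g.y_mem
  sum_weight := by
    have h := Fin.sum_univ_succ g.s
    rw [Fin.sum_univ_castSucc, g.s_zero, g.s_last] at h
    rw [Finset.sum_sub_distrib]
    linarith
  isWeight := by
    refine ⟨fun i => ⟨K.sub_mem (g.s_mem _) (g.s_mem _),
      sub_nonneg.mpr (g.s_strictMono (Fin.castSucc_lt_succ)).le⟩, ?_⟩
    have h := Fin.sum_univ_succ g.s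
    rw [Fin.sum_univ_castSucc, g.s_zero, g.s_last] at h
    rw [Finset.sum_sub_distrib]
    linarith

theorem ofReal_tail_tuple (s : ℝ) :
    ENNReal.ofReal (g.tuple.tail s) = volume {u | u ∈ Ico (0 : ℝ) 1 ∧ s < g.toFun u} := by
  have hset : {u | u ∈ Ico (0 : ℝ) 1 ∧ s < g.toFun u} =
      ⋃ i ∈ Finset.univ.filter (fun i => s < g.y i), Ico (g.s i.castSucc) (g.s i.succ) := by
    ext u
    simp only [mem_ofPred_eq, Finset.mem_filter, Finset.mem_univ, true_and, mem_iUnion, exists_prop]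
    constructor
    · rintro ⟨hu, hs⟩
      obtain ⟨i, hi⟩ := g.exists_mem_Ico hu
      rw [g.toFun_eq hi] at hs
      exact ⟨i, hs, hi⟩
    · rintro ⟨i, hs, hi⟩
      refine ⟨⟨?_, ?_⟩, by rwa [g.toFun_eq hi]⟩
      · rw [← g.s_zero]
        exact (g.s_strictMono.monotone (Fin.zero_le _)).trans hi.1
      · rw [← g.s_last]
        exact hi.2.trans_le (g.s_strictMono.monotone (Fin.le_last _))
  rw [hset, measure_biUnion_finset]
  · simp only [Real.volume_Ico]
    rw [WeightedTuple.tail, tailSum, ← Finset.sum_filter, ENNReal.ofReal_sum_of_nonneg]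
    · rfl
    · exact fun i _ => g.tuple.weight_nonneg i
  · intro i _ j _ hij
    rw [Function.onFun, Set.disjoint_left]
    intro u hi hj
    rcases lt_or_gt_of_ne hij with h | h
    · have : g.s i.succ ≤ g.s j.castSucc :=
        g.s_strictMono.monotone (Fin.succ_le_castSucc_iff.mpr h)
      linarith [hi.2, hj.1]
    · have : g.s j.succ ≤ g.s i.castSucc :=
        g.s_strictMono.monotone (Fin.succ_le_castSucc_iff.mpr h)
      linarith [hj.2, hi.1]
  · exact fun i _ => measurableSet_Ico

end SimpleFn

theorem WeightedMean.simple_eq_val (M : WeightedMean K I) (g : SimpleFn K I) :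
    M.simple g = M.val g.tuple := rfl

/-! ### The neighbourhoods B_ε -/

/-- A continuous function on `[0, 1]` is uniformly approximated by a `K`-simple function. -/
theorem exists_simpleFn_near {φ : ℝ → ℝ} (hφ : ContinuousOn φ (Icc 0 1))
    (hI : MapsTo φ (Ico 0 1) I) {ε : ℝ} (hε : 0 < ε) :
    ∃ g : SimpleFn K I, ∀ u ∈ Ico (0 : ℝ) 1,
      (∃ v ∈ Ico (0 : ℝ) 1, g.toFun u = φ v) ∧ |φ u - g.toFun u| ≤ ε := by
  have huc := isCompact_Icc.uniformContinuousOn_of_continuous hφ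
  rw [Metric.uniformContinuousOn_iff] at huc
  obtain ⟨δ, hδ, huc⟩ := huc ε hε
  obtain ⟨N, hN⟩ := exists_nat_one_div_lt hδ
  have hN0 : (0 : ℝ) < N + 1 := by positivity
  have hmem : ∀ i : Fin (N + 1), (i : ℝ) / (N + 1) ∈ Ico (0 : ℝ) 1 := by
    intro i
    refine ⟨by positivity, (div_lt_one hN0).mpr ?_⟩
    exact_mod_cast i.2
  let g : SimpleFn K I :=
    { n := N + 1
      s := fun i => (i : ℝ) / (N + 1)
      y := fun i => φ ((i : ℝ) / (N + 1))
      s_mem := fun i => K.div_mem (natCast_mem K _) (K.add_mem (natCast_mem K _) K.one_mem)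
      s_strictMono := fun i j hij => by
        have : (i : ℝ) < j := by exact_mod_cast hij
        exact div_lt_div_of_pos_right this hN0
      s_zero := by simp
      s_last := by
        simp only [Fin.val_last]
        push_cast
        exact div_self hN0.ne'
      y_mem := fun i => hI (hmem i) }
  refine ⟨g, fun u hu => ?_⟩
  obtain ⟨i, hi⟩ := g.exists_mem_Ico hu
  have h1 : (i : ℝ) / (N + 1) ≤ u := hi.1
  have h2 : u < ((i : ℝ) + 1) / (N + 1) := by
    have := hi.2
    simpa [g] using this
  rw [g.toFun_eq hi]
  refine ⟨⟨_, hmem i, rfl⟩, ?_⟩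
  have hd : dist u ((i : ℝ) / (N + 1)) < δ := by
    rw [Real.dist_eq, abs_of_nonneg (by linarith)]
    rw [add_div] at h2
    linarith
  exact (huc u ⟨hu.1, hu.2.le⟩ _ ⟨(hmem i).1, (hmem i).2.le⟩ hd).le

theorem rangeHull_subset {f : ℝ → ℝ} {S : Set ℝ} (hS : IsClosed S) (hc : Convex ℝ S)
    (h : MapsTo f (Ico 0 1) S) : rangeHull f ⊆ S :=
  closure_minimal (convexHull_min h.image_subset hc) hS

theorem Icc_subset_rangeHull {f : ℝ → ℝ} {u v : ℝ} (hu : u ∈ Ico (0 : ℝ) 1)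
    (hv : v ∈ Ico (0 : ℝ) 1) : Icc (f u) (f v) ⊆ rangeHull f :=
  ((convex_convexHull ℝ _).ordConnected.out (subset_convexHull ℝ _ (mem_image_of_mem f hu))
    (subset_convexHull ℝ _ (mem_image_of_mem f hv))).trans subset_closure

theorem exists_abs_sub_lt {f : ℝ → ℝ} {ε : ℝ} {g : SimpleFn K I}
    (hg : g ∈ nhdSimple K I ε f) : ∃ u ∈ Ico (0 : ℝ) 1, |f u - g.toFun u| < ε := by
  by_contra! hcon
  have h1 : ∫⁻ u in Ico (0 : ℝ) 1, ENNReal.ofReal ε ≤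
      ∫⁻ u in Ico (0 : ℝ) 1, ENNReal.ofReal |f u - g.toFun u| :=
    setLIntegral_mono' measurableSet_Ico fun u hu => ENNReal.ofReal_le_ofReal (hcon u hu)
  rw [setLIntegral_const, Real.volume_Ico] at h1
  simp only [sub_zero, ENNReal.ofReal_one, mul_one] at h1
  exact absurd hg.2 (not_lt.mpr h1)

/-- This is where the range hull condition acts. Closeness in L¹ gives a point where g < S + ε; a
value above S + 2ε elsewhere would put an interval of length ε into the hull of g but outside that
of f. -/
theorem toFun_le_of_mem_nhdSimple {f : ℝ → ℝ} {ε S : ℝ} (hε : 0 < ε) {g : SimpleFn K I}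
    (hg : g ∈ nhdSimple K I ε f) (hf : ∀ u ∈ Ico (0 : ℝ) 1, f u ≤ S) {u : ℝ}
    (hu : u ∈ Ico (0 : ℝ) 1) : g.toFun u ≤ S + 2 * ε := by
  by_contra! hcon
  obtain ⟨v, hv, hvε⟩ := exists_abs_sub_lt hg
  have hv1 := abs_lt.mp hvε
  have hfv := hf v hv
  have hsub : Icc (S + ε) (S + 2 * ε) ⊆ rangeHull g.toFun \ rangeHull f := by
    rintro z ⟨hz1, hz2⟩
    refine ⟨Icc_subset_rangeHull hv hu ⟨by linarith, by linarith⟩, fun hz => ?_⟩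
    have : z ≤ S := rangeHull_subset isClosed_Iic (convex_Iic S) hf hz
    linarith
  have := (measure_mono hsub).trans_lt hg.1
  rw [Real.volume_Icc, show S + 2 * ε - (S + ε) = ε by ring] at this
  exact lt_irrefl _ this

theorem le_toFun_of_mem_nhdSimple {f : ℝ → ℝ} {ε S : ℝ} (hε : 0 < ε) {g : SimpleFn K I}
    (hg : g ∈ nhdSimple K I ε f) (hf : ∀ u ∈ Ico (0 : ℝ) 1, S ≤ f u) {u : ℝ}
    (hu : u ∈ Ico (0 : ℝ) 1) : S - 2 * ε ≤ g.toFun u := by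
  by_contra! hcon
  obtain ⟨v, hv, hvε⟩ := exists_abs_sub_lt hg
  have hv1 := abs_lt.mp hvε
  have hfv := hf v hv
  have hsub : Icc (S - 2 * ε) (S - ε) ⊆ rangeHull g.toFun \ rangeHull f := by
    rintro z ⟨hz1, hz2⟩
    refine ⟨Icc_subset_rangeHull hu hv ⟨by linarith, by linarith⟩, fun hz => ?_⟩
    have : S ≤ z := rangeHull_subset isClosed_Ici (convex_Ici S) hf hz
    linarith
  have := (measure_mono hsub).trans_lt hg.1
  rw [Real.volume_Icc, show S - ε - (S - 2 * ε) = ε by ring] at this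
  exact lt_irrefl _ this

theorem nhdSimple_mono {f : ℝ → ℝ} {ε ε' : ℝ} (h : ε ≤ ε') :
    nhdSimple K I ε f ⊆ nhdSimple K I ε' f := fun _ hg =>
  ⟨hg.1.trans_le (ENNReal.ofReal_le_ofReal h), hg.2.trans_le (ENNReal.ofReal_le_ofReal h)⟩

theorem abs_sub_clamp_le {a b z y : ℝ} (ha : a ≤ y) (hb : y ≤ b) :
    |z - max a (min b z)| ≤ |y - z| := by
  rcases le_total z a with h1 | h1 <;> rcases le_total b z with h2 | h2 <;>
    simp only [h1, h2, min_eq_left, min_eq_right, max_eq_left, max_eq_right, ha.trans hb] <;>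
    rw [abs_le] <;> constructor <;>
    cases abs_cases (y - z) <;> linarith

theorem abs_clamp_sub_clamp_le (a b z y : ℝ) :
    |max a (min b z) - max a (min b y)| ≤ |z - y| := by
  rw [max_comm a, max_comm a, min_comm b, min_comm b]
  exact (abs_max_sub_max_le_abs _ _ _).trans
    ((abs_min_sub_min_le_max z b y b).trans (by simp))

/-- Truncation at two of its values changes an integrable function little. -/
theorem exists_clamp_near {f : ℝ → ℝ} (hf : IntegrableOn f (Ico 0 1)) {ε : ℝ≥0∞} (hε : 0 < ε) :
    ∃ a ∈ f '' Ico 0 1, ∃ b ∈ f '' Ico 0 1, a ≤ b ∧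
      ∫⁻ u in Ico (0 : ℝ) 1, ENNReal.ofReal |f u - max a (min b (f u))| < ε := by
  obtain ⟨f', hf'm, hff'⟩ := hf.aestronglyMeasurable.aemeasurable
  have h0 : f 0 ∈ f '' Ico 0 1 := ⟨0, by simp, rfl⟩
  -- These approximants take values in the range of f itself, so their least and greatest values are
  -- attained by f and can serve as truncation bounds.
  have hlim := SimpleFunc.tendsto_approxOn_L1_enorm hf'm h0
    (μ := volume.restrict (Ico (0 : ℝ) 1)) (by
      filter_upwards [hff', ae_restrict_mem measurableSet_Ico] with u hu hu'
      rw [← hu]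
      exact subset_closure ⟨u, hu', rfl⟩)
    (((hf.congr hff').sub (integrable_const (f 0))).2)
  obtain ⟨N, hN⟩ := (hlim.eventually (gt_mem_nhds hε)).exists
  set σ := SimpleFunc.approxOn f' hf'm (f '' Ico 0 1) (f 0) h0 N with hσ
  have hσmem : ∀ u, σ u ∈ f '' Ico 0 1 := fun u => SimpleFunc.approxOn_mem hf'm h0 N u
  have hne : σ.range.Nonempty := ⟨σ 0, SimpleFunc.mem_range_self σ 0⟩
  have hrange : ∀ z ∈ σ.range, z ∈ f '' Ico 0 1 := by
    intro z hz
    obtain ⟨u, rfl⟩ := SimpleFunc.mem_range.mp hz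
    exact hσmem u
  refine ⟨σ.range.min' hne, hrange _ (Finset.min'_mem _ _), σ.range.max' hne,
    hrange _ (Finset.max'_mem _ _), Finset.min'_le _ _ (Finset.max'_mem _ _), ?_⟩
  refine lt_of_le_of_lt (lintegral_mono_ae ?_) hN
  filter_upwards [hff'] with u hu
  rw [← hu, Real.enorm_eq_ofReal_abs]
  exact ENNReal.ofReal_le_ofReal (abs_sub_clamp_le
    (Finset.min'_le _ _ (SimpleFunc.mem_range_self σ u))
    (Finset.le_max' _ _ (SimpleFunc.mem_range_self σ u)))

/-- A continuous L¹ approximation of f, truncated at two attained values of f, stays in I and inside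
the range hull of f. Its uniform approximation by a simple function therefore adds nothing to the
hull. -/
theorem nhdSimple_nonempty (hI : I.OrdConnected) {f : ℝ → ℝ} (hf : IntegrableOn f (Ico 0 1))
    (hfI : MapsTo f (Ico 0 1) I) {ε : ℝ} (hε : 0 < ε) : (nhdSimple K I ε f).Nonempty := by
  have hε4 : 0 < ε / 4 := by positivity
  obtain ⟨a, ha, b, hb, hab, hclamp⟩ := exists_clamp_near hf (ENNReal.ofReal_pos.mpr hε4)
  obtain ⟨φ, hφ, -⟩ := Integrable.exists_boundedContinuous_lintegral_sub_le
    (μ := volume.restrict (Ico (0 : ℝ) 1)) hf (ENNReal.ofReal_pos.mpr hε4).ne'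
  have haI : a ∈ I := hfI.image_subset ha
  have hbI : b ∈ I := hfI.image_subset hb
  set ψ : ℝ → ℝ := fun u => max a (min b (φ u)) with hψ
  have hψc : Continuous ψ := continuous_const.max (continuous_const.min φ.continuous)
  have hψab : ∀ u, ψ u ∈ Icc a b := fun u => ⟨le_max_left _ _, max_le hab (min_le_left _ _)⟩
  obtain ⟨g, hg⟩ := exists_simpleFn_near (K := K) (I := I) hψc.continuousOn
    (fun u _ => hI.out haI hbI (hψab u)) hε4
  refine ⟨g, ?_, ?_⟩
  · obtain ⟨ua, hua, rfl⟩ := ha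
    obtain ⟨ub, hub, rfl⟩ := hb
    have hsub : rangeHull g.toFun ⊆ rangeHull f := by
      refine (rangeHull_subset isClosed_Icc (convex_Icc (f ua) (f ub)) fun u hu => ?_).trans
        (Icc_subset_rangeHull hua hub)
      obtain ⟨⟨v, -, hv⟩, -⟩ := hg u hu
      rw [hv]
      exact hψab v
    rw [sdiff_eq_empty.mpr hsub, measure_empty]
    exact ENNReal.ofReal_pos.mpr hε
  · have hfm := hf.aestronglyMeasurable.aemeasurable
    calc ∫⁻ u in Ico (0 : ℝ) 1, ENNReal.ofReal |f u - g.toFun u|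
        ≤ ∫⁻ u in Ico (0 : ℝ) 1, (ENNReal.ofReal |f u - max a (min b (f u))| +
            (‖f u - φ u‖ₑ + ENNReal.ofReal (ε / 4))) := by
          refine setLIntegral_mono' measurableSet_Ico fun u hu => ?_
          rw [Real.enorm_eq_ofReal_abs, ← ENNReal.ofReal_add (abs_nonneg _) hε4.le,
            ← ENNReal.ofReal_add (abs_nonneg _) (by positivity)]
          refine ENNReal.ofReal_le_ofReal ?_
          have h1 := (hg u hu).2
          have h2 := abs_clamp_sub_clamp_le a b (f u) (φ u)
          have h3 := abs_sub_le (f u) (max a (min b (f u))) (g.toFun u)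
          have h4 := abs_sub_le (max a (min b (f u))) (ψ u) (g.toFun u)
          simp only [hψ] at h1 h4
          linarith
      _ = (∫⁻ u in Ico (0 : ℝ) 1, ENNReal.ofReal |f u - max a (min b (f u))|) +
            ((∫⁻ u in Ico (0 : ℝ) 1, ‖f u - φ u‖ₑ) + ENNReal.ofReal (ε / 4)) := by
          rw [lintegral_add_right', lintegral_add_right]
          · simp
          · exact measurable_const
          · exact ((hfm.sub φ.continuous.aemeasurable).enorm).add aemeasurable_const
      _ ≤ ENNReal.ofReal (ε / 4) + (ENNReal.ofReal (ε / 4) + ENNReal.ofReal (ε / 4)) := by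
          exact add_le_add hclamp.le (add_le_add hφ le_rfl)
      _ < ENNReal.ofReal ε := by
          rw [← ENNReal.ofReal_add hε4.le hε4.le, ← ENNReal.ofReal_add hε4.le (by positivity)]
          exact (ENNReal.ofReal_lt_ofReal_iff hε).mpr (by linarith)

theorem integrableOn_rescale {f : ℝ → ℝ} (hf : IntegrableOn f (Ici 0)) {t : ℝ} (ht : 0 < t) :
    IntegrableOn (rescale 0 t f) (Ico 0 1) := by
  have h : IntegrableOn f (Ico 0 t) := hf.mono_set Ico_subset_Ici_self
  rw [← integrable_indicator_iff measurableSet_Ico] at h ⊢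
  have h2 := h.comp_mul_right' ht.ne'
  refine h2.congr (Filter.Eventually.of_forall fun u => ?_)
  simp only [indicator, mem_Ico, rescale, sub_zero, zero_add]
  have h1 : (0 ≤ u * t ∧ u * t < t) ↔ (0 ≤ u ∧ u < 1) := by
    rw [mul_nonneg_iff_of_pos_right ht, mul_lt_iff_lt_one_left ht]
  simp only [h1]

theorem mapsTo_rescale {f : ℝ → ℝ} (hf : MapsTo f (Ici 0) I) {t : ℝ} (ht : 0 < t) :
    MapsTo (rescale 0 t f) (Ico 0 1) I := by
  intro u hu
  apply hf
  have := mul_nonneg hu.1 ht.le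
  simpa using this

theorem WeightedMean.lower_le_upper (M : WeightedMean K I) (hI : I.OrdConnected) {f : ℝ → ℝ}
    (hf : IntegrableOn f (Ici 0)) (hfI : MapsTo f (Ici 0) I) {t : ℝ} (ht : 0 < t) :
    M.lower 0 t f ≤ M.upper 0 t f := by
  refine iSup_le fun ε => le_iInf fun ε' => ?_
  obtain ⟨g, hg⟩ := nhdSimple_nonempty (K := K) hI (integrableOn_rescale hf ht)
    (mapsTo_rescale hfI ht) (lt_min ε.2 ε'.2)
  exact (iInf₂_le g (nhdSimple_mono (min_le_left _ _) hg)).trans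
    (le_iSup₂ (f := fun (g : SimpleFn K I) _ => (M.simple g : EReal)) g
      (nhdSimple_mono (min_le_right _ _) hg))

/-! ### Finite forms of the discrete Hardy inequality -/

theorem le_of_forall_le_add_mul_one_div {a b c : ℝ≥0∞} (hc : c ≠ ∞)
    (h : ∀ n : ℕ, a ≤ b + c * ENNReal.ofReal (1 / ((n : ℝ) + 1))) : a ≤ b := by
  have h1 : Filter.Tendsto (fun n : ℕ => ENNReal.ofReal (1 / ((n : ℝ) + 1))) Filter.atTop
      (nhds 0) := by
    simpa using ENNReal.tendsto_ofReal tendsto_one_div_add_atTop_nhds_zero_nat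
  have h2 := (ENNReal.Tendsto.const_mul h1 (Or.inr hc)).const_add b
  rw [mul_zero, add_zero] at h2
  exact ge_of_tendsto' h2 h

theorem one_div_mem (K : Subfield ℝ) (n : ℕ) : 1 / ((n : ℝ) + 1) ∈ K :=
  K.div_mem K.one_mem (K.add_mem (natCast_mem K _) K.one_mem)

theorem mem_of_pos_of_le (hI : I.OrdConnected) (hI0 : IsGLB I 0) {p z : ℝ} (hp : p ∈ I)
    (hz : 0 < z) (hzp : z ≤ p) : z ∈ I := by
  obtain ⟨a, ha, -, haz⟩ := hI0.exists_between hz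
  exact hI.out ha hp ⟨haz.le, hzp⟩

/-- The Hardy inequality of the mean holds with the constant `C`. -/
def WeightedMean.IsHardyBound (M : WeightedMean K I) (C : ℝ≥0∞) : Prop :=
  ∀ x w : ℕ → ℝ, (∀ n, x n ∈ I ∧ 0 < x n) → (∀ n, w n ∈ K ∧ 0 < w n) →
    ∑' n, ENNReal.ofReal
        (w n * M.toFun (n + 1) (fun i : Fin (n + 1) => x i) (fun i : Fin (n + 1) => w i))
      ≤ C * ∑' n, ENNReal.ofReal (w n * x n)

/-- A Hardy inequality entails the inequality for the partial sums. -/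
theorem WeightedMean.IsHardyBound.sum_range_le {M : WeightedMean K I} {C : ℝ≥0∞}
    (hC : M.IsHardyBound C) (hC' : C ≠ ∞) {x w : ℕ → ℝ} (hx : ∀ n, x n ∈ I ∧ 0 < x n)
    (hw : ∀ n, w n ∈ K ∧ 0 < w n) (N : ℕ) :
    ∑ n ∈ Finset.range N, ENNReal.ofReal
        (w n * M.toFun (n + 1) (fun i : Fin (n + 1) => x i) (fun i : Fin (n + 1) => w i))
      ≤ C * ∑ n ∈ Finset.range N, ENNReal.ofReal (w n * x n) := by
  refine le_of_forall_le_add_mul_one_div (c := C * (ENNReal.ofReal (x 0) * 2))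
    (ENNReal.mul_ne_top hC' (ENNReal.mul_ne_top ENNReal.ofReal_ne_top (by simp))) fun q => ?_
  set δ : ℝ := 1 / ((q : ℝ) + 1) with hδ
  have hδ0 : 0 < δ := by positivity
  -- The Hardy inequality requires infinite sequences of positive terms. The continuation has
  -- geometric weights of total at most 2δ, which is negligible on the right.
  set x' : ℕ → ℝ := fun n => if n < N then x n else x 0 with hx'
  set w' : ℕ → ℝ := fun n => if n < N then w n else δ * (1 / 2) ^ n with hw'
  have h := hC x' w' (fun n => by simp only [hx']; split_ifs <;> exact hx _) (fun n => by
    simp only [hw']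
    split_ifs
    · exact hw n
    · exact ⟨K.mul_mem (one_div_mem K q) (K.pow_mem (K.div_mem K.one_mem (ofNat_mem K 2)) _),
        by positivity⟩)
  calc _ = ∑ n ∈ Finset.range N, ENNReal.ofReal (w' n * M.toFun (n + 1)
          (fun i : Fin (n + 1) => x' i) (fun i : Fin (n + 1) => w' i)) := by
        refine Finset.sum_congr rfl fun n hn => ?_
        have hnN := Finset.mem_range.mp hn
        have hi : ∀ i : Fin (n + 1), (i : ℕ) < N := fun i => by omega
        simp only [hx', hw', hnN, hi, if_true]
    _ ≤ _ := (ENNReal.sum_le_tsum _).trans h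
    _ ≤ C * ∑' n, ((if n < N then ENNReal.ofReal (w n * x n) else 0) +
          ENNReal.ofReal δ * ENNReal.ofReal (x 0) * (2⁻¹ : ℝ≥0∞) ^ n) := by
        gcongr with n
        simp only [hx', hw']
        split_ifs
        · exact le_self_add
        · rw [zero_add, ENNReal.ofReal_mul (by positivity), ENNReal.ofReal_mul hδ0.le,
            ENNReal.ofReal_pow (by norm_num), one_div, ENNReal.ofReal_inv_of_pos (by norm_num)]
          rw [mul_right_comm]
          simp
    _ = _ := by
        rw [ENNReal.tsum_add, ENNReal.tsum_mul_left, ENNReal.tsum_geometric,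
          tsum_eq_sum (s := Finset.range N) (fun n hn => if_neg (by simpa using hn)), mul_add]
        congr 1
        · congr 1
          exact Finset.sum_congr rfl fun n hn => if_pos (Finset.mem_range.mp hn)
        · rw [ENNReal.one_sub_inv_two, inv_inv]
          ring

/-- The layer cake formula for a finite weighted sum. -/
theorem lintegral_ofReal_tailSum {n : ℕ} {x w : Fin n → ℝ} (hw : ∀ i, 0 ≤ w i) :
    ∫⁻ s in Ioi (0 : ℝ), ENNReal.ofReal (tailSum x w s) = ∑ i, ENNReal.ofReal (w i * x i) := by
  have h : ∀ s, ENNReal.ofReal (tailSum x w s) =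
      ∑ i, (Iio (x i)).indicator (fun _ => ENNReal.ofReal (w i)) s := by
    intro s
    rw [tailSum, ENNReal.ofReal_sum_of_nonneg]
    · refine Finset.sum_congr rfl fun i _ => ?_
      by_cases hs : s < x i
      · simp [hs]
      · simp [hs]
    · intro i _
      split_ifs
      · exact hw i
      · rfl
  simp only [h]
  rw [lintegral_finsetSum _ fun i _ => measurable_const.indicator measurableSet_Iio]
  refine Finset.sum_congr rfl fun i _ => ?_
  rw [lintegral_indicator measurableSet_Iio, setLIntegral_const,
    Measure.restrict_apply measurableSet_Iio, inter_comm, Ioi_inter_Iio, Real.volume_Ioo, sub_zero,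
    ENNReal.ofReal_mul (hw i)]

/-! ### The envelope of finitely many tuples -/

/-- The tuples whose stretched tail function exceeds `m` by at most `ε` on average, where `t` is
the length to which `[0, 1)` is stretched. -/
def excessTuples (K : Subfield ℝ) (I : Set ℝ) (m : ℝ → ℝ≥0∞) (ε t : ℝ) :
    Set (WeightedTuple K I) :=
  {d | ∃ E : ℝ → ℝ≥0∞, Measurable E ∧
    (∀ s, 0 < s → ENNReal.ofReal (d.tail s) ≤ m s / ENNReal.ofReal t + E s) ∧
    ∫⁻ s in Ioi (0 : ℝ), E s ≤ ENNReal.ofReal ε}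

/-- The total weight of the entries that are at least the `i`-th one. -/
noncomputable def levelSum {n : ℕ} (x w : Fin n → ℝ) (i : Fin n) : ℝ :=
  ∑ j, if x i ≤ x j then w j else 0

theorem levelSum_le_tailSum {n : ℕ} {x w : Fin n → ℝ} (hw : ∀ i, 0 ≤ w i) {i : Fin n} {s : ℝ}
    (h : s < x i) : levelSum x w i ≤ tailSum x w s := by
  refine Finset.sum_le_sum fun j _ => ?_
  by_cases hj : x i ≤ x j
  · rw [if_pos hj, if_pos (h.trans_le hj)]
  · rw [if_neg hj]
    split_ifs
    · exact hw j
    · rfl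

theorem exists_tailSum_eq_levelSum {n : ℕ} {x w : Fin n → ℝ} {s : ℝ} (h : 0 < tailSum x w s) :
    ∃ i, s < x i ∧ tailSum x w s = levelSum x w i := by
  have hne : (Finset.univ.filter fun i => s < x i).Nonempty := by
    by_contra hcon
    rw [Finset.not_nonempty_iff_eq_empty, Finset.filter_eq_empty_iff] at hcon
    refine h.ne' (Finset.sum_eq_zero fun i hi => if_neg (hcon hi))
  obtain ⟨i, hi, hmin⟩ := Finset.exists_min_image _ x hne
  simp only [Finset.mem_filter, Finset.mem_univ, true_and] at hi hmin
  refine ⟨i, hi, Finset.sum_congr rfl fun j _ => ?_⟩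
  by_cases hj : s < x j
  · rw [if_pos hj, if_pos (hmin j hj)]
  · rw [if_neg hj, if_neg fun hij => hj (hi.trans_le hij)]

/-- The cells [iω, (i+1)ω) that start before P cover [0, P) as far as the first J cells reach. -/
theorem min_le_sum_ite {ω P : ℝ} (hω : 0 ≤ ω) (J : ℕ) :
    min P (J * ω) ≤ ∑ i ∈ Finset.range J, if (i : ℝ) * ω < P then ω else 0 := by
  induction J with
  | zero => simp
  | succ J ih =>
    by_cases h : (J : ℝ) * ω < P
    · have : ∀ i ∈ Finset.range (J + 1), (if (i : ℝ) * ω < P then ω else 0) = ω := by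
        intro i hi
        have hiJ : (i : ℝ) ≤ J := by exact_mod_cast Nat.lt_succ_iff.mp (Finset.mem_range.mp hi)
        exact if_pos ((mul_le_mul_of_nonneg_right hiJ hω).trans_lt h)
      rw [Finset.sum_congr rfl this, Finset.sum_const, Finset.card_range, nsmul_eq_mul]
      exact min_le_right _ _
    · rw [Finset.sum_range_succ, if_neg h, add_zero]
      rw [not_lt] at h
      rw [min_eq_left h] at ih
      exact (min_le_left _ _).trans ih

section Envelope

variable {N : ℕ} (d : Fin N → WeightedTuple K I) (τ ω κ : ℝ)

/-- The candidates for the `j`-th term of the least nonincreasing sequence on a grid of step `ω`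
whose initial piece of length `(k + 1) τ` dominates the stretched tuple `d k` for every `k`. -/
noncomputable def envelopeValues (j : ℕ) : Finset ℝ :=
  insert κ (((Finset.univ : Finset (Σ k : Fin N, Fin (d k).n)).filter
    fun p => (j : ℝ) * ω < ((p.1 : ℝ) + 1) * τ * levelSum (d p.1).entry (d p.1).weight p.2).image
      fun p => (d p.1).entry p.2)

/-- The maximum of the candidates. -/
noncomputable def envelope (j : ℕ) : ℝ :=
  (envelopeValues d τ ω κ j).max' (Finset.insert_nonempty _ _)

variable {d τ ω κ}

theorem le_envelope (j : ℕ) : κ ≤ envelope d τ ω κ j :=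
  Finset.le_max' _ _ (Finset.mem_insert_self _ _)

theorem envelope_cases (j : ℕ) : envelope d τ ω κ j = κ ∨
    ∃ (k : Fin N) (i : Fin (d k).n),
      (j : ℝ) * ω < ((k : ℝ) + 1) * τ * levelSum (d k).entry (d k).weight i ∧
      envelope d τ ω κ j = (d k).entry i := by
  have h := Finset.max'_mem (envelopeValues d τ ω κ j) (Finset.insert_nonempty _ _)
  refine (Finset.mem_insert.mp h).imp_right fun h => ?_
  obtain ⟨p, hp, h⟩ := Finset.mem_image.mp h
  exact ⟨p.1, p.2, (Finset.mem_filter.mp hp).2, h.symm⟩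

theorem envelope_mem (hκ : κ ∈ I) (j : ℕ) : envelope d τ ω κ j ∈ I := by
  rcases envelope_cases (d := d) (τ := τ) (ω := ω) (κ := κ) j with h | ⟨k, i, -, h⟩
  · rwa [h]
  · rw [h]
    exact (d k).entry_mem i

theorem lt_envelope {j : ℕ} {k : Fin N} {s : ℝ} (hω : 0 ≤ ω) (hτ : 0 < τ)
    (h : (j : ℝ) * ω < ((k : ℝ) + 1) * τ * (d k).tail s) : s < envelope d τ ω κ j := by
  have hpos : 0 < (d k).tail s := by
    have h1 : 0 < ((k : ℝ) + 1) * τ * (d k).tail s := lt_of_le_of_lt (by positivity) h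
    exact (pos_iff_pos_of_mul_pos h1).mp (by positivity)
  obtain ⟨i, hi, hlev⟩ := exists_tailSum_eq_levelSum hpos
  rw [WeightedTuple.tail, hlev] at h
  refine hi.trans_le (Finset.le_max' (envelopeValues d τ ω κ j) _
    (Finset.mem_insert_of_mem (Finset.mem_image.mpr ⟨⟨k, i⟩, ?_, rfl⟩)))
  exact Finset.mem_filter.mpr ⟨Finset.mem_univ _, h⟩

theorem isWeight_const {n : ℕ} (hω : 0 < ω) (hωK : ω ∈ K) :
    IsWeight K (fun _ : Fin (n + 1) => ω) :=
  ⟨fun _ => ⟨hωK, hω.le⟩, by simp; positivity⟩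

/-- The envelope exceeds s on every cell that starts before (k+1)τ times the tail of `d k` at s.
Initial pieces shorter than (k+1)τ are allowed too: truncating a nonincreasing sequence only raises
its normalized tail. -/
theorem val_le_toFun_envelope {M : WeightedMean K I} (hsymm : M.IsSymmetric)
    (hmono : M.IsMonotone) (hω : 0 < ω) (hωK : ω ∈ K) (hτ : 0 < τ) (hκ : κ ∈ I) (k : Fin N)
    {j : ℕ} (hj : ((j : ℝ) + 1) * ω ≤ ((k : ℝ) + 1) * τ) :
    M.val (d k) ≤ M.toFun (j + 1) (fun i => envelope d τ ω κ i) (fun _ => ω) := by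
  have hw := isWeight_const (K := K) (n := j) hω hωK
  rw [← M.val_normalize (fun i : Fin (j + 1) => envelope d τ ω κ i) (fun _ => ω)
    (fun i => envelope_mem hκ _) hw]
  refine M.val_le_val hsymm hmono fun s => ?_
  rw [WeightedTuple.tail_normalize, le_inv_mul_iff₀ hw.2]
  have h1 : ∑ i ∈ Finset.range (j + 1),
      (if (i : ℝ) * ω < ((k : ℝ) + 1) * τ * (d k).tail s then ω else 0)
      ≤ tailSum (fun i : Fin (j + 1) => envelope d τ ω κ i) (fun _ => ω) s := by
    rw [Finset.sum_range, tailSum]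
    refine Finset.sum_le_sum fun i _ => ?_
    split_ifs with ha hb hb
    · rfl
    · exact absurd (lt_envelope hω.le hτ ha) hb
    · exact hω.le
    · rfl
  refine le_trans ?_ ((min_le_sum_ite hω.le (j + 1)).trans h1)
  have h0 := (d k).tail_nonneg s
  have h2 := (d k).tail_le_one s
  have hJ : 0 < ((j : ℝ) + 1) * ω := by positivity
  simp only [Finset.sum_const, Finset.card_univ, Fintype.card_fin, nsmul_eq_mul, Nat.cast_add,
    Nat.cast_one]
  refine le_min ?_ ?_
  · exact mul_le_mul_of_nonneg_right hj h0
  · nlinarith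

/-- The last index at which the envelope exceeds s takes its value from a single tuple, and that
tuple alone accounts for all cells up to this index, except for one step ω. -/
theorem tailSum_envelope_le (hω : 0 ≤ ω) (J : ℕ) {s : ℝ} (hs : κ ≤ s)
    (hpos : 0 < tailSum (fun j : Fin J => envelope d τ ω κ j) (fun _ => ω) s) (hτ : 0 < τ) :
    ∃ (k : Fin N) (i : Fin (d k).n), s < (d k).entry i ∧
      tailSum (fun j : Fin J => envelope d τ ω κ j) (fun _ => ω) s
        ≤ ((k : ℝ) + 1) * τ * (d k).tail s + ω := by
  have hne : (Finset.univ.filter fun j : Fin J => s < envelope d τ ω κ j).Nonempty := by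
    by_contra hcon
    rw [Finset.not_nonempty_iff_eq_empty, Finset.filter_eq_empty_iff] at hcon
    exact hpos.ne' (Finset.sum_eq_zero fun i hi => if_neg (hcon hi))
  obtain ⟨j, hj, hmax⟩ := Finset.exists_max_image _ id hne
  simp only [Finset.mem_filter, Finset.mem_univ, true_and, id] at hj hmax
  rcases envelope_cases (d := d) (τ := τ) (ω := ω) (κ := κ) j with h | ⟨k, i, hlt, h⟩
  · rw [h] at hj
    exact absurd hs (not_le.mpr hj)
  · rw [h] at hj
    refine ⟨k, i, hj, ?_⟩
    have h1 : tailSum (fun j : Fin J => envelope d τ ω κ j) (fun _ => ω) s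
        ≤ partialWeight (fun _ : Fin J => ω) (j + 1) := by
      refine Finset.sum_le_sum fun l _ => ?_
      by_cases hl : s < envelope d τ ω κ l
      · rw [if_pos hl, if_pos (Nat.lt_succ_of_le (hmax l hl))]
      · rw [if_neg hl]
        split_ifs
        · exact hω
        · rfl
    have h2 : ∀ n ≤ J, partialWeight (fun _ : Fin J => ω) n = n * ω := by
      intro n
      induction n with
      | zero => simp [partialWeight_zero]
      | succ n ih =>
        intro hn
        have := partialWeight_succ (w := fun _ : Fin J => ω) ⟨n, hn⟩
        simp only at this
        rw [this, ih (by omega)]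
        push_cast
        ring
    rw [h2 _ (Nat.succ_le_of_lt j.2)] at h1
    have h3 : _ ≤ ((k : ℝ) + 1) * τ * (d k).tail s :=
      mul_le_mul_of_nonneg_left (levelSum_le_tailSum (d k).weight_nonneg hj)
        (show 0 ≤ ((k : ℝ) + 1) * τ by positivity)
    push_cast at h1
    linarith

end Envelope

theorem sum_range_mul_eq {A : Type*} [AddCommMonoid A] (f : ℕ → A) (N L : ℕ) :
    ∑ k ∈ Finset.range N, ∑ l ∈ Finset.range L, f (k * L + l)
      = ∑ j ∈ Finset.range (N * L), f j := by
  induction N with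
  | zero => simp
  | succ N ih => rw [Finset.sum_range_succ, ih, Nat.succ_mul, Finset.sum_range_add]

/-- The discrete Hardy inequality is applied to the envelope with constant weights ω. The integral
of m enters only once, however many tuples there are, because the envelope's tail is controlled by
one tuple at each level. -/
theorem sum_val_le {M : WeightedMean K I} (hI : I.OrdConnected) (hI0 : IsGLB I 0)
    (hsymm : M.IsSymmetric) (hmono : M.IsMonotone) {C : ℝ≥0∞}
    (hC : M.IsHardyBound C) (hC' : C ≠ ∞) {m : ℝ → ℝ≥0∞} (hm : Measurable m) {τ ε : ℝ}
    (hτ : 0 < τ) (hτK : τ ∈ K) {N : ℕ} (d : Fin N → WeightedTuple K I)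
    (hd : ∀ k : Fin N, d k ∈ excessTuples K I m ε (((k : ℝ) + 1) * τ)) :
    ∑ k, ENNReal.ofReal (τ * M.val (d k)) ≤
      C * ((∫⁻ s in Ioi (0 : ℝ), m s) +
        ∑ k : Fin N, ENNReal.ofReal (((k : ℝ) + 1) * τ) * ENNReal.ofReal ε) := by
  by_cases hp : ∃ p ∈ I, 0 < p
  swap
  · have : ∀ k, ENNReal.ofReal (τ * M.val (d k)) = 0 := by
      intro k
      rw [ENNReal.ofReal_eq_zero]
      have : M.val (d k) ≤ 0 := by
        by_contra! hcon
        exact hp ⟨_, M.val_mem (d k), hcon⟩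
      exact mul_nonpos_of_nonneg_of_nonpos hτ.le this
    simp [this]
  obtain ⟨p, hpI, hp⟩ := hp
  choose E hEm hE hEε using hd
  obtain ⟨B, hB⟩ := (Set.finite_range
    fun q : Σ k : Fin N, Fin (d k).n => (d q.1).entry q.2).bddAbove
  have hB' : ∀ (k : Fin N) (i : Fin (d k).n), (d k).entry i ≤ B := fun k i => hB ⟨⟨k, i⟩, rfl⟩
  refine le_of_forall_le_add_mul_one_div
    (c := C * (ENNReal.ofReal (N * τ) * ENNReal.ofReal p + ENNReal.ofReal τ * ENNReal.ofReal B))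
    (by finiteness) fun q => ?_
  set δ : ℝ := 1 / ((q : ℝ) + 1) with hδ
  have hδ0 : 0 < δ := by positivity
  have hδ1 : δ ≤ 1 := by rw [hδ, div_le_one (by positivity)]; linarith [q.cast_nonneg (α := ℝ)]
  set ω : ℝ := τ * δ with hωdef
  have hω : 0 < ω := by positivity
  have hωK : ω ∈ K := K.mul_mem hτK (one_div_mem K q)
  have hLω : ((q : ℝ) + 1) * ω = τ := by rw [hωdef, hδ]; field_simp
  set κ : ℝ := p * δ with hκdef
  have hκ : 0 < κ := by positivity
  -- The floor κ makes every term of the envelope positive, as the Hardy inequality demands, even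
  -- where no tuple contributes; its cost Nτκ vanishes with δ.
  have hκI : κ ∈ I := mem_of_pos_of_le hI hI0 hpI hκ (by nlinarith)
  set X : ℕ → ℝ := envelope d τ ω κ with hX
  have hard := hC.sum_range_le hC' (x := X) (w := fun _ => ω)
    (fun n => ⟨envelope_mem hκI n, hκ.trans_le (le_envelope n)⟩) (fun _ => ⟨hωK, hω⟩)
    (N * (q + 1))
  have hleft : ∑ k, ENNReal.ofReal (τ * M.val (d k)) ≤
      ∑ n ∈ Finset.range (N * (q + 1)), ENNReal.ofReal
        (ω * M.toFun (n + 1) (fun i : Fin (n + 1) => X i) (fun _ => ω)) := by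
    -- Each block of length τ consists of q + 1 cells. The initial pieces that end in block k have
    -- length at most (k+1)τ, so each of their means is at least that of `d k`.
    rw [← sum_range_mul_eq, Finset.sum_range]
    refine Finset.sum_le_sum fun k _ => ?_
    have h1 : ENNReal.ofReal (τ * M.val (d k)) =
        ∑ l ∈ Finset.range (q + 1), ENNReal.ofReal (ω * M.val (d k)) := by
      have hnn : 0 ≤ M.val (d k) := hI0.1 (M.val_mem _)
      rw [← ENNReal.ofReal_sum_of_nonneg (fun _ _ => by positivity), Finset.sum_const,
        Finset.card_range, nsmul_eq_mul, ← mul_assoc]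
      push_cast
      rw [hLω]
    rw [h1]
    refine Finset.sum_le_sum fun l hl => ENNReal.ofReal_le_ofReal ?_
    refine mul_le_mul_of_nonneg_left ?_ hω.le
    refine val_le_toFun_envelope hsymm hmono hω hωK hτ hκI k ?_
    have hl' : (l : ℝ) + 1 ≤ (q : ℝ) + 1 := by exact_mod_cast Finset.mem_range.mp hl
    push_cast
    rw [← hLω]
    nlinarith
  have hright : ∑ n ∈ Finset.range (N * (q + 1)), ENNReal.ofReal (ω * X n) ≤
      ENNReal.ofReal (N * τ) * ENNReal.ofReal κ + ENNReal.ofReal ω * ENNReal.ofReal B +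
        ((∫⁻ s in Ioi (0 : ℝ), m s) +
          ∑ k : Fin N, ENNReal.ofReal (((k : ℝ) + 1) * τ) * ENNReal.ofReal ε) := by
    rw [Finset.sum_range,
      ← lintegral_ofReal_tailSum (x := fun n : Fin (N * (q + 1)) => X n) (fun _ => hω.le)]
    calc ∫⁻ s in Ioi (0 : ℝ), ENNReal.ofReal
            (tailSum (fun n : Fin (N * (q + 1)) => X n) (fun _ => ω) s)
        ≤ ∫⁻ s in Ioi (0 : ℝ), (((Iio κ).indicator (fun _ => ENNReal.ofReal (N * τ)) s +
            (Iio B).indicator (fun _ => ENNReal.ofReal ω) s) +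
            (m s + ∑ k : Fin N, ENNReal.ofReal (((k : ℝ) + 1) * τ) * E k s)) := by
          refine setLIntegral_mono' measurableSet_Ioi fun s hs => ?_
          -- Below κ the total length Nτ is a sufficient bound. Above κ one tuple controls the tail,
          -- and the extra step ω is charged only up to the largest entry bound B.
          rcases lt_or_ge s κ with hsκ | hsκ
          · have h1 : tailSum (fun n : Fin (N * (q + 1)) => X n) (fun _ => ω) s ≤ N * τ := by
              refine (tailSum_le_sum (fun _ => hω.le) s).trans_eq ?_
              rw [← hLω]
              simp [mul_assoc]
            rw [indicator_of_mem (show s ∈ Iio κ from hsκ), add_assoc]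
            exact (ENNReal.ofReal_le_ofReal h1).trans le_self_add
          · rcases (tailSum_nonneg (x := fun n : Fin (N * (q + 1)) => X n)
              (fun _ => hω.le) s).eq_or_lt with h0 | hpos
            · rw [← h0]
              simp
            · obtain ⟨k, i, hi, hle⟩ := tailSum_envelope_le hω.le _ hsκ hpos hτ
              have hk : 0 < ((k : ℝ) + 1) * τ := by positivity
              rw [indicator_of_mem (show s ∈ Iio B from hi.trans_le (hB' k i)),
                indicator_of_notMem (show s ∉ Iio κ from not_lt.mpr hsκ), zero_add]
              refine (ENNReal.ofReal_le_ofReal hle).trans ?_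
              rw [ENNReal.ofReal_add (mul_nonneg hk.le ((d k).tail_nonneg s)) hω.le, add_comm,
                ENNReal.ofReal_mul hk.le]
              gcongr
              calc ENNReal.ofReal (((k : ℝ) + 1) * τ) * ENNReal.ofReal ((d k).tail s)
                  ≤ ENNReal.ofReal (((k : ℝ) + 1) * τ) *
                      (m s / ENNReal.ofReal (((k : ℝ) + 1) * τ) + E k s) := by
                    gcongr
                    exact hE k s hs
                _ = m s + ENNReal.ofReal (((k : ℝ) + 1) * τ) * E k s := by
                    rw [mul_add, ENNReal.mul_div_cancel (ENNReal.ofReal_pos.mpr hk).ne'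
                      ENNReal.ofReal_ne_top]
                _ ≤ _ := by
                    gcongr
                    exact Finset.single_le_sum
                      (f := fun k : Fin N => ENNReal.ofReal (((k : ℝ) + 1) * τ) * E k s)
                      (fun _ _ => zero_le) (Finset.mem_univ k)
      _ ≤ _ := by
          have hsumm : Measurable fun s => ∑ k : Fin N,
              ENNReal.ofReal (((k : ℝ) + 1) * τ) * E k s :=
            Finset.measurable_fun_sum _ fun k _ => (hEm k).const_mul _
          have hmsum : Measurable fun s => m s + ∑ k : Fin N,
              ENNReal.ofReal (((k : ℝ) + 1) * τ) * E k s := hm.add hsumm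
          rw [lintegral_add_right _ hmsum, lintegral_add_right _ hsumm,
            lintegral_add_right _ (measurable_const.indicator measurableSet_Iio),
            lintegral_finsetSum _ fun k _ => (hEm k).const_mul _,
            lintegral_indicator measurableSet_Iio, lintegral_indicator measurableSet_Iio,
            setLIntegral_const, setLIntegral_const, Measure.restrict_apply measurableSet_Iio,
            Measure.restrict_apply measurableSet_Iio, inter_comm, Ioi_inter_Iio, Real.volume_Ioo,
            inter_comm, Ioi_inter_Iio, Real.volume_Ioo, sub_zero, sub_zero]
          gcongr with k
          rw [lintegral_const_mul _ (hEm k)]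
          gcongr
          exact hEε k
  refine (hleft.trans hard).trans ((mul_le_mul_right hright C).trans_eq ?_)
  rw [hκdef, hωdef, ENNReal.ofReal_mul hp.le, ENNReal.ofReal_mul hτ.le]
  ring

/-! ### The upper mean is bounded by a nonincreasing majorant -/

theorem lintegral_superlevel (f : ℝ → ℝ) (hf : IntegrableOn f (Ici 0))
    (h0 : ∀ t, 0 ≤ t → 0 ≤ f t) :
    ∫⁻ s in Ioi (0 : ℝ), volume {t | t ∈ Ici (0 : ℝ) ∧ s ≤ f t}
      = ∫⁻ t in Ioi (0 : ℝ), ENNReal.ofReal (f t) := by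
  have hr : volume.restrict (Ioi (0 : ℝ)) = volume.restrict (Ici 0) :=
    Measure.restrict_congr_set Ioi_ae_eq_Ici
  conv_rhs => rw [hr, lintegral_eq_lintegral_meas_le (volume.restrict (Ici (0 : ℝ)))
      (ae_restrict_of_forall_mem measurableSet_Ici h0) hf.aestronglyMeasurable.aemeasurable]
  refine lintegral_congr fun s => ?_
  rw [Measure.restrict_apply' measurableSet_Ici, inter_comm]
  rfl

theorem measurable_superlevel (f : ℝ → ℝ) :
    Measurable fun s : ℝ => volume {t | t ∈ Ici (0 : ℝ) ∧ s ≤ f t} := by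
  refine Antitone.measurable fun s s' h => measure_mono fun t ht => ?_
  exact ⟨ht.1, h.trans ht.2⟩

/-- The simple functions near the restriction of `f` to `[0, t)`, stretched to `[0, t)`, hardly
exceed `f` in distribution. -/
theorem tuple_mem_excessTuples {f : ℝ → ℝ} (hf : IntegrableOn f (Ici 0)) {t ε : ℝ} (ht : 0 < t)
    {g : SimpleFn K I} (hg : g ∈ nhdSimple K I ε (rescale 0 t f)) :
    g.tuple ∈ excessTuples K I (fun s => volume {t | t ∈ Ici (0 : ℝ) ∧ s ≤ f t}) ε t := by
  set μ : Measure ℝ := volume.restrict (Ico (0 : ℝ) 1) with hμ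
  obtain ⟨F, hFm, hF⟩ := (integrableOn_rescale hf ht).aestronglyMeasurable.aemeasurable
  -- R is the region above f and below g. Its horizontal sections measure the excess of the tail of
  -- g, and by Tonelli their total is at most the L¹ distance.
  set R : Set (ℝ × ℝ) := {q | F q.1 < q.2 ∧ q.2 < g.toFun q.1} with hR
  have hRm : MeasurableSet R :=
    (measurableSet_lt (hFm.comp measurable_fst) measurable_snd).inter
      (measurableSet_lt measurable_snd (g.measurable_toFun.comp measurable_fst))
  refine ⟨fun s => μ ((fun u => (u, s)) ⁻¹' R), measurable_measure_prodMk_right hRm,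
    fun s hs => ?_, ?_⟩
  · rw [g.ofReal_tail_tuple]
    have hsub : {u | u ∈ Ico (0 : ℝ) 1 ∧ s < g.toFun u} ⊆
        {u | u ∈ Ico (0 : ℝ) 1 ∧ s ≤ rescale 0 t f u} ∪
          (((fun u => (u, s)) ⁻¹' R ∩ Ico 0 1) ∪ ({u | rescale 0 t f u ≠ F u} ∩ Ico 0 1)) := by
      rintro u ⟨hu, hsu⟩
      by_cases h1 : rescale 0 t f u = F u
      · rcases le_or_gt s (rescale 0 t f u) with h2 | h2
        · exact Or.inl ⟨hu, h2⟩
        · exact Or.inr (Or.inl ⟨⟨by simpa [← h1] using h2, hsu⟩, hu⟩)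
      · exact Or.inr (Or.inr ⟨h1, hu⟩)
    refine (measure_mono hsub).trans ((measure_union_le _ _).trans (add_le_add ?_
      ((measure_union_le _ _).trans ?_)))
    · have hpre : {u | u ∈ Ico (0 : ℝ) 1 ∧ s ≤ rescale 0 t f u} ⊆
          (fun u => u * t) ⁻¹' {τ | τ ∈ Ici (0 : ℝ) ∧ s ≤ f τ} := by
        rintro u ⟨hu, hsu⟩
        exact ⟨mul_nonneg hu.1 ht.le, by simpa [rescale] using hsu⟩
      refine (measure_mono hpre).trans_eq ?_
      rw [Real.volume_preimage_mul_right ht.ne', abs_of_pos (inv_pos.mpr ht),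
        ENNReal.ofReal_inv_of_pos ht, mul_comm, div_eq_mul_inv]
    · have hnull : volume ({u | rescale 0 t f u ≠ F u} ∩ Ico 0 1) = 0 := by
        rw [← Measure.restrict_apply' measurableSet_Ico]
        exact hF
      rw [hnull, add_zero, ← Measure.restrict_apply' measurableSet_Ico]
  · calc ∫⁻ s in Ioi (0 : ℝ), μ ((fun u => (u, s)) ⁻¹' R)
        ≤ ∫⁻ s, μ ((fun u => (u, s)) ⁻¹' R) := setLIntegral_le_lintegral _ _
      _ = ∫⁻ u, volume (Prod.mk u ⁻¹' R) ∂μ := by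
          rw [← Measure.prod_apply_symm hRm, Measure.prod_apply hRm]
      _ ≤ ∫⁻ u in Ico (0 : ℝ) 1, ENNReal.ofReal |rescale 0 t f u - g.toFun u| := by
          refine lintegral_mono_ae ?_
          filter_upwards [hF] with u hu
          have : Prod.mk u ⁻¹' R = Ioo (F u) (g.toFun u) := rfl
          rw [this, Real.volume_Ioo, hu]
          exact ENNReal.ofReal_le_ofReal (by rw [abs_sub_comm]; exact le_abs_self _)
      _ ≤ ENNReal.ofReal ε := hg.2.le

/-- The tuple with a single entry. -/
noncomputable def WeightedTuple.const (K : Subfield ℝ) {z : ℝ} (hz : z ∈ I) :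
    WeightedTuple K I where
  n := 1
  entry := fun _ => z
  weight := fun _ => 1
  entry_mem := fun _ => hz
  isWeight := ⟨fun _ => ⟨K.one_mem, zero_le_one⟩, by simp⟩
  sum_weight := by simp

/-- Since inf I = 0, a constant tuple with value below ε exists, and its whole tail can be counted
as error. -/
theorem excessTuples_nonempty (hI0 : IsGLB I 0) (m : ℝ → ℝ≥0∞) {ε : ℝ}
    (hε : 0 < ε) (t : ℝ) : (excessTuples K I m ε t).Nonempty := by
  obtain ⟨z, hz, -, hzε⟩ := hI0.exists_between hε
  refine ⟨WeightedTuple.const K hz, fun s => ENNReal.ofReal ((WeightedTuple.const K hz).tail s),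
    (Antitone.measurable (WeightedTuple.tail_antitone _)).ennreal_ofReal,
    fun s _ => le_add_self, ?_⟩
  refine (lintegral_ofReal_tailSum (WeightedTuple.weight_nonneg _)).trans_le ?_
  change ∑ i : Fin 1, ENNReal.ofReal (1 * z) ≤ _
  rw [Fin.sum_univ_one, one_mul]
  exact ENNReal.ofReal_le_ofReal hzε.le

/-- The least upper bound of the means of the tuples that do not exceed `m`, stretched to
`[0, t)`, in distribution by a substantial amount. -/
noncomputable def WeightedMean.majorant (M : WeightedMean K I) (m : ℝ → ℝ≥0∞) (t : ℝ) : ℝ≥0∞ :=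
  ⨅ n : ℕ, ⨆ d ∈ excessTuples K I m (1 / ((n : ℝ) + 1)) t, ENNReal.ofReal (M.val d)

theorem WeightedMean.majorant_antitone (M : WeightedMean K I) (m : ℝ → ℝ≥0∞) :
    Antitone (M.majorant m) := by
  intro t t' h
  refine iInf_mono fun n => biSup_mono fun d hd => ?_
  obtain ⟨E, hEm, hE, hEε⟩ := hd
  refine ⟨E, hEm, fun s hs => (hE s hs).trans ?_, hEε⟩
  gcongr

theorem WeightedMean.toENNReal_upper_le (M : WeightedMean K I) {f : ℝ → ℝ}
    (hf : IntegrableOn f (Ici 0)) {t : ℝ} (ht : 0 < t) :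
    (M.upper 0 t f).toENNReal ≤
      M.majorant (fun s => volume {t | t ∈ Ici (0 : ℝ) ∧ s ≤ f t}) t := by
  refine le_iInf fun n => ?_
  have hn : (0 : ℝ) < 1 / ((n : ℝ) + 1) := by positivity
  have h : M.upper 0 t f ≤ ((⨆ d ∈ excessTuples K I
      (fun s => volume {t | t ∈ Ici (0 : ℝ) ∧ s ≤ f t}) (1 / ((n : ℝ) + 1)) t,
        ENNReal.ofReal (M.val d) : ℝ≥0∞) : EReal) := by
    refine (iInf_le _ ⟨_, hn⟩).trans (iSup₂_le fun g hg => ?_)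
    have h1 : ENNReal.ofReal (M.val g.tuple) ≤ ⨆ d ∈ excessTuples K I
        (fun s => volume {t | t ∈ Ici (0 : ℝ) ∧ s ≤ f t}) (1 / ((n : ℝ) + 1)) t,
        ENNReal.ofReal (M.val d) :=
      le_iSup₂ (f := fun (d : WeightedTuple K I) _ => ENNReal.ofReal (M.val d)) g.tuple
        (tuple_mem_excessTuples hf ht hg)
    refine le_trans ?_ (EReal.coe_ennreal_le_coe_ennreal_iff.mpr h1)
    rw [M.simple_eq_val, EReal.coe_ennreal_ofReal]
    exact EReal.coe_le_coe_iff.mpr (le_max_left _ _)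
  simpa using EReal.toENNReal_le_toENNReal h

/-- The choices for different k are independent, so a bound on all sums of chosen values bounds the
sum of the suprema. The summand c carries the values already chosen through the induction. -/
theorem add_sum_biSup_le {α : Type*} (F : α → ℝ≥0∞) (B : ℝ≥0∞) {N : ℕ} (A : Fin N → Set α)
    (hA : ∀ k, (A k).Nonempty) (c : ℝ≥0∞)
    (h : ∀ d : Fin N → α, (∀ k, d k ∈ A k) → c + ∑ k, F (d k) ≤ B) :
    c + ∑ k, ⨆ a ∈ A k, F a ≤ B := by
  induction N generalizing c with
  | zero => simpa using h Fin.elim0 (fun k => k.elim0)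
  | succ N ih =>
    rw [Fin.sum_univ_succ, ← add_assoc, ENNReal.add_biSup (hA 0), ENNReal.biSup_add (hA 0)]
    refine iSup₂_le fun a ha => ih (fun k => A k.succ) (fun k => hA _) _ fun d hd => ?_
    have := h (Fin.cons a d) (fun k => Fin.cases ha hd k)
    rw [Fin.sum_univ_succ, ← add_assoc] at this
    simpa using this

/-! ### The integral inequality from the discrete one -/

section HardyBound

variable {M : WeightedMean K I} {C : ℝ≥0∞} {m : ℝ → ℝ≥0∞}

/-- For a fixed excess ε the tuples at the finitely many nodes are chosen independently and
`sum_val_le` applies. The error is a fixed finite multiple of ε, so ε can tend to 0. -/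
theorem sum_majorant_le (hI : I.OrdConnected) (hI0 : IsGLB I 0)
    (hsymm : M.IsSymmetric) (hmono : M.IsMonotone) (hC : M.IsHardyBound C) (hC' : C ≠ ∞)
    (hm : Measurable m) {τ : ℝ} (hτ : 0 < τ) (hτK : τ ∈ K) (N : ℕ) :
    ∑ k : Fin N, ENNReal.ofReal τ * M.majorant m (((k : ℝ) + 1) * τ) ≤
      C * ∫⁻ s in Ioi (0 : ℝ), m s := by
  refine le_of_forall_le_add_mul_one_div
    (c := C * ∑ k : Fin N, ENNReal.ofReal (((k : ℝ) + 1) * τ))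
    (ENNReal.mul_ne_top hC' (ENNReal.sum_ne_top.mpr fun _ _ => ENNReal.ofReal_ne_top)) fun n => ?_
  have hn : (0 : ℝ) < 1 / ((n : ℝ) + 1) := by positivity
  calc ∑ k : Fin N, ENNReal.ofReal τ * M.majorant m (((k : ℝ) + 1) * τ)
      ≤ ∑ k : Fin N, ⨆ d ∈ excessTuples K I m (1 / ((n : ℝ) + 1)) (((k : ℝ) + 1) * τ),
          ENNReal.ofReal (τ * M.val d) := by
        refine Finset.sum_le_sum fun k _ => ?_
        simp only [ENNReal.ofReal_mul hτ.le, ← ENNReal.mul_iSup]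
        gcongr
        exact iInf_le _ n
    _ ≤ _ := by
        have := add_sum_biSup_le (fun d : WeightedTuple K I => ENNReal.ofReal (τ * M.val d))
          (C * ((∫⁻ s in Ioi (0 : ℝ), m s) + ∑ k : Fin N, ENNReal.ofReal (((k : ℝ) + 1) * τ) *
            ENNReal.ofReal (1 / ((n : ℝ) + 1))))
          (fun k : Fin N => excessTuples K I m (1 / ((n : ℝ) + 1)) (((k : ℝ) + 1) * τ))
          (fun k => excessTuples_nonempty hI0 m hn _) 0 (fun d hd => by
            rw [zero_add]
            exact sum_val_le hI hI0 hsymm hmono hC hC' hm hτ hτK d hd)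
        rw [zero_add] at this
        refine this.trans_eq ?_
        rw [← Finset.sum_mul, mul_add, mul_assoc]

theorem setLIntegral_le_tsum_of_antitone {V : ℝ → ℝ≥0∞} (hV : Antitone V) {τ : ℝ} (hτ : 0 < τ) :
    ∫⁻ t in Ioi τ, V t ≤ ∑' k : ℕ, ENNReal.ofReal τ * V (((k : ℝ) + 1) * τ) := by
  have hsub : Ioi τ ⊆ ⋃ k : ℕ, Ico (((k : ℝ) + 1) * τ) (((k : ℝ) + 2) * τ) := by
    intro t ht
    have ht' : τ < t := ht
    have h1 : 1 ≤ t / τ := by rw [le_div_iff₀ hτ]; linarith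
    have h2 : 1 ≤ ⌊t / τ⌋₊ := Nat.le_floor (by simpa using h1)
    obtain ⟨k, hk⟩ := Nat.exists_eq_add_of_le' h2
    have h3 := Nat.floor_le (show 0 ≤ t / τ by linarith)
    have h4 := Nat.lt_floor_add_one (t / τ)
    rw [hk] at h3 h4
    push_cast at h3 h4
    rw [le_div_iff₀ hτ] at h3
    rw [div_lt_iff₀ hτ] at h4
    exact mem_iUnion.mpr ⟨k, h3, by linarith⟩
  refine (lintegral_mono_set hsub).trans ((lintegral_iUnion_le _ _).trans ?_)
  refine ENNReal.tsum_le_tsum fun k => ?_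
  calc ∫⁻ t in Ico (((k : ℝ) + 1) * τ) (((k : ℝ) + 2) * τ), V t
      ≤ ∫⁻ t in Ico (((k : ℝ) + 1) * τ) (((k : ℝ) + 2) * τ), V (((k : ℝ) + 1) * τ) :=
        setLIntegral_mono' measurableSet_Ico fun t ht => hV ht.1
    _ = _ := by
        rw [setLIntegral_const, Real.volume_Ico, mul_comm]
        congr 2
        ring

/-- The Riemann sum with nodes (k+1)τ misses (0, τ], where the majorant may be unbounded. The bound
does not depend on τ, so τ = 1/(q+1) → 0 exhausts the half-line. -/
theorem lintegral_majorant_le (hI : I.OrdConnected) (hI0 : IsGLB I 0)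
    (hsymm : M.IsSymmetric) (hmono : M.IsMonotone) (hC : M.IsHardyBound C) (hC' : C ≠ ∞)
    (hm : Measurable m) :
    ∫⁻ t in Ioi (0 : ℝ), M.majorant m t ≤ C * ∫⁻ s in Ioi (0 : ℝ), m s := by
  have hU : Ioi (0 : ℝ) = ⋃ q : ℕ, Ioi (1 / ((q : ℝ) + 1)) := by
    ext t
    simp only [mem_Ioi, mem_iUnion]
    exact ⟨fun h => exists_nat_one_div_lt h, fun ⟨q, hq⟩ => lt_trans (by positivity) hq⟩
  have hmonoU : Monotone fun q : ℕ => Ioi (1 / ((q : ℝ) + 1)) := fun q q' h =>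
    Ioi_subset_Ioi (Nat.one_div_le_one_div h)
  conv_lhs => rw [hU]
  rw [setLIntegral_iUnion_of_directed _ hmonoU.directed_le]
  refine iSup_le fun q => ?_
  refine (setLIntegral_le_tsum_of_antitone (M.majorant_antitone m) (by positivity)).trans ?_
  rw [ENNReal.tsum_eq_iSup_nat]
  refine iSup_le fun N => ?_
  rw [Finset.sum_range]
  exact sum_majorant_le hI hI0 hsymm hmono hC hC' hm (by positivity) (one_div_mem K q) N

/-- The Hardy inequality entails the integral Hardy inequality for the upper mean. -/
theorem lintegral_upper_le (hI : I.OrdConnected) (hI0 : IsGLB I 0)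
    (hsymm : M.IsSymmetric) (hmono : M.IsMonotone) (hC : M.IsHardyBound C) (hC' : C ≠ ∞)
    {f : ℝ → ℝ} (hfI : MapsTo f (Ici 0) I) (hf : IntegrableOn f (Ici 0)) :
    ∫⁻ t in Ioi (0 : ℝ), (M.upper 0 t f).toENNReal ≤
      C * ∫⁻ t in Ioi (0 : ℝ), ENNReal.ofReal (f t) := by
  have h0 : ∀ t, 0 ≤ t → 0 ≤ f t := fun t ht => hI0.1 (hfI ht)
  rw [← lintegral_superlevel f hf h0]
  refine le_trans ?_ (lintegral_majorant_le hI hI0 hsymm hmono hC hC'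
    (measurable_superlevel f))
  exact setLIntegral_mono' measurableSet_Ioi fun t ht => M.toENNReal_upper_le hf ht

end HardyBound

theorem integralHardyConst_upper_le {M : WeightedMean K I} (hI : I.OrdConnected)
    (hI0 : IsGLB I 0) (hsymm : M.IsSymmetric) (hmono : M.IsMonotone) :
    integralHardyConst I M.upper ≤ M.hardyConst := by
  refine le_sInf fun C hC => ?_
  by_cases hC' : C = ∞
  · rw [hC']
    exact le_top
  · exact sInf_le fun f hfI hf _ => lintegral_upper_le hI hI0 hsymm hmono hC hC' hfI hf

theorem integralHardyConst_lower_le_upper {M : WeightedMean K I} (hI : I.OrdConnected) :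
    integralHardyConst I M.lower ≤ integralHardyConst I M.upper := by
  refine le_sInf fun C hC => sInf_le fun f hfI hf hD => ?_
  refine le_trans ?_ (hC f hfI hf hD)
  exact setLIntegral_mono' measurableSet_Ioi fun t ht =>
    EReal.toENNReal_le_toENNReal (M.lower_le_upper hI hf hfI ht)

/-- The functional is that of the lower mean and there are fewer functions to test. -/
theorem integralHardyConstOn_ext_le_lower {M : WeightedMean K I} :
    integralHardyConstOn I M.ExtDefined M.ext ≤ integralHardyConst I M.lower :=
  le_sInf fun _ hC => sInf_le fun f hfI hf _ =>
    hC f hfI hf (Filter.Eventually.of_forall fun _ => trivial)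

/-! ### Means of simple functions near a continuous decreasing function -/

/-- The super-level set of `f` in `[0, 1)`. -/
def superlevel (f : ℝ → ℝ) (s : ℝ) : Set ℝ := {u | u ∈ Ico (0 : ℝ) 1 ∧ s < f u}

theorem superlevel_mono {f₁ f₂ : ℝ → ℝ} {s₁ s₂ : ℝ}
    (h : ∀ u ∈ Ico (0 : ℝ) 1, s₁ < f₁ u → s₂ < f₂ u) : superlevel f₁ s₁ ⊆ superlevel f₂ s₂ :=
  fun u hu => ⟨hu.1, h u hu.1 hu.2⟩

theorem superlevel_eq_Ico {f : ℝ → ℝ} {s : ℝ} (h : ∀ u ∈ Ico (0 : ℝ) 1, s < f u) :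
    superlevel f s = Ico 0 1 :=
  Subset.antisymm (fun _ hu => hu.1) fun u hu => ⟨hu, h u hu⟩

/-- By uniform continuity a decreasing f needs a length of at least δ to descend by η. A margin in
height thus yields a margin in measure, uniformly in s, except at levels at the ends of the range.
-/
theorem exists_volume_superlevel_gap {f : ℝ → ℝ} (hf : Continuous f) (hfa : Antitone f) {η : ℝ}
    (hη : 0 < η) : ∃ δ : ℝ, 0 < δ ∧ ∀ s, superlevel f (s + η) = ∅ ∨
      (∀ u ∈ Ico (0 : ℝ) 1, s < f u) ∨
      volume (superlevel f (s + η)) + ENNReal.ofReal δ ≤ volume (superlevel f s) := by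
  have huc := isCompact_Icc (a := (0 : ℝ)) (b := 1) |>.uniformContinuousOn_of_continuous
    hf.continuousOn
  rw [Metric.uniformContinuousOn_iff] at huc
  obtain ⟨δ, hδ, huc⟩ := huc η hη
  refine ⟨δ, hδ, fun s => ?_⟩
  rcases (superlevel f (s + η)).eq_empty_or_nonempty with h | hne
  · exact Or.inl h
  by_cases hall : ∀ u ∈ Ico (0 : ℝ) 1, s < f u
  · exact Or.inr (Or.inl hall)
  refine Or.inr (Or.inr ?_)
  push Not at hall
  obtain ⟨v, hv, hfv⟩ := hall
  set A := superlevel f (s + η) with hA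
  have hbdd : BddAbove A := ⟨1, fun u hu => hu.1.2.le⟩
  set p := sSup A with hp
  have hclose : ∀ z ∈ Ico (0 : ℝ) 1, z < p + δ → s < f z := by
    intro z hz hzp
    obtain ⟨a, ha, hza⟩ := exists_lt_of_lt_csSup hne (show z - δ < p by linarith)
    rcases le_total z a with h | h
    · have := hfa h
      linarith [ha.2]
    · have := huc a ⟨ha.1.1, ha.1.2.le⟩ z ⟨hz.1, hz.2.le⟩
        (by rw [Real.dist_eq, abs_sub_comm, abs_of_nonneg (by linarith)]; linarith)
      rw [Real.dist_eq] at this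
      linarith [ha.2, (abs_lt.mp this).2]
  have hpv : p + δ ≤ v := by
    by_contra! hcon
    exact absurd (hclose v hv hcon) (not_lt.mpr hfv)
  have hp0 : 0 ≤ p := by
    obtain ⟨a, ha⟩ := hne
    exact ha.1.1.trans (le_csSup hbdd ha)
  have h1 : volume A ≤ ENNReal.ofReal p := by
    refine (measure_mono (t := Icc 0 p) fun u hu => ⟨hu.1.1, le_csSup hbdd hu⟩).trans_eq ?_
    rw [Real.volume_Icc, sub_zero]
  have h2 : ENNReal.ofReal (p + δ) ≤ volume (superlevel f s) := by
    have : Ico 0 (p + δ) ⊆ superlevel f s := fun z hz =>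
      have hz1 : z ∈ Ico (0 : ℝ) 1 := ⟨hz.1, by linarith [hz.2, hv.2]⟩
      ⟨hz1, hclose z hz1 hz.2⟩
    refine le_trans ?_ (measure_mono this)
    rw [Real.volume_Ico, sub_zero]
  rw [ENNReal.ofReal_add hp0 hδ.le] at h2
  exact (add_le_add_left h1 _).trans h2

/-- Markov's inequality. -/
theorem volume_le_abs_sub_le {f : ℝ → ℝ} (hf : Measurable f) {ε c : ℝ} (hc : 0 < c)
    {g : SimpleFn K I} (hg : g ∈ nhdSimple K I ε f) :
    volume {u | u ∈ Ico (0 : ℝ) 1 ∧ c ≤ |f u - g.toFun u|} ≤ ENNReal.ofReal (ε / c) := by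
  have h := mul_meas_ge_le_lintegral (μ := volume.restrict (Ico (0 : ℝ) 1))
    (f := fun u => ENNReal.ofReal |f u - g.toFun u|)
    ((continuous_abs.measurable.comp (hf.sub g.measurable_toFun)).ennreal_ofReal)
    (ENNReal.ofReal c)
  rw [Measure.restrict_apply' measurableSet_Ico] at h
  rw [ENNReal.ofReal_div_of_pos hc, ENNReal.le_div_iff_mul_le (Or.inl
    (ENNReal.ofReal_pos.mpr hc).ne') (Or.inl ENNReal.ofReal_ne_top), mul_comm]
  refine le_trans ?_ (h.trans hg.2.le)
  gcongr
  exact fun u hu => ⟨ENNReal.ofReal_le_ofReal hu.2, hu.1⟩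

theorem SimpleFn.ofReal_tail_tuple_eq_superlevel (g : SimpleFn K I) (s : ℝ) :
    ENNReal.ofReal (g.tuple.tail s) = volume (superlevel g.toFun s) :=
  g.ofReal_tail_tuple s

section Gap

variable {M : WeightedMean K I} {f : ℝ → ℝ} {d : WeightedTuple K I} {η : ℝ}

/-- Half of the margin η is turned into a gap δ in measure; the other half absorbs |f - g| outside a
set of measure at most δ. At the levels without a gap, the range hull condition bounds g directly.
-/
theorem exists_val_le_simple (hsymm : M.IsSymmetric) (hmono : M.IsMonotone)
    (hf : Continuous f) (hfa : Antitone f) (hη : 0 < η)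
    (h : ∀ s, ENNReal.ofReal (d.tail s) ≤ volume (superlevel f (s + η))) :
    ∃ ε : ℝ, 0 < ε ∧ ∀ g ∈ nhdSimple K I ε f, M.val d ≤ M.simple g := by
  -- Below, ε ≤ δη/2 serves Markov's inequality at height η/2, and ε ≤ η/8 keeps the uniform
  -- deviation 2ε under η/2.
  obtain ⟨δ, hδ, hgap⟩ := exists_volume_superlevel_gap hf hfa (half_pos hη)
  have hε : 0 < min (δ * (η / 2)) (η / 8) := by positivity
  refine ⟨_, hε, fun g hg => ?_⟩
  set ε := min (δ * (η / 2)) (η / 8) with hεdef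
  have hε1 : ε ≤ δ * (η / 2) := min_le_left _ _
  have hε2 : ε ≤ η / 8 := min_le_right _ _
  rw [M.simple_eq_val]
  refine M.val_le_val hsymm hmono fun s => ?_
  rw [← ENNReal.ofReal_le_ofReal_iff (g.tuple.tail_nonneg s), g.ofReal_tail_tuple_eq_superlevel]
  refine (h s).trans ?_
  rcases hgap (s + η / 2) with h1 | h1 | h1
  · rw [add_assoc, add_halves] at h1
    rw [h1, measure_empty]
    exact zero_le
  · rw [superlevel_eq_Ico (f := g.toFun)]
    · exact measure_mono fun u hu => hu.1
    · intro u hu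
      have := le_toFun_of_mem_nhdSimple hε hg (fun v hv => (h1 v hv).le) hu
      linarith
  · rw [add_assoc, add_halves] at h1
    have hsub : superlevel f (s + η / 2) ⊆ superlevel g.toFun s ∪
        {u | u ∈ Ico (0 : ℝ) 1 ∧ η / 2 ≤ |f u - g.toFun u|} := by
      rintro u ⟨hu, hfu⟩
      rcases lt_or_ge s (g.toFun u) with h2 | h2
      · exact Or.inl ⟨hu, h2⟩
      · exact Or.inr ⟨hu, le_trans (by linarith) (le_abs_self _)⟩
    have h3 : volume (superlevel f (s + η / 2)) ≤
        volume (superlevel g.toFun s) + ENNReal.ofReal δ := by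
      refine (measure_mono hsub).trans ((measure_union_le _ _).trans (add_le_add_right ?_ _))
      refine (volume_le_abs_sub_le hf.measurable (half_pos hη) hg).trans
        (ENNReal.ofReal_le_ofReal ?_)
      rwa [div_le_iff₀ (half_pos hη)]
    exact (ENNReal.add_le_add_iff_right ENNReal.ofReal_ne_top).mp (h1.trans h3)

theorem exists_simple_le_val (hsymm : M.IsSymmetric) (hmono : M.IsMonotone)
    (hf : Continuous f) (hfa : Antitone f) (hη : 0 < η)
    (h : ∀ s, volume (superlevel f (s - η)) ≤ ENNReal.ofReal (d.tail s)) :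
    ∃ ε : ℝ, 0 < ε ∧ ∀ g ∈ nhdSimple K I ε f, M.simple g ≤ M.val d := by
  obtain ⟨δ, hδ, hgap⟩ := exists_volume_superlevel_gap hf hfa (half_pos hη)
  have hε : 0 < min (δ * (η / 2)) (η / 8) := by positivity
  refine ⟨_, hε, fun g hg => ?_⟩
  set ε := min (δ * (η / 2)) (η / 8) with hεdef
  have hε1 : ε ≤ δ * (η / 2) := min_le_left _ _
  have hε2 : ε ≤ η / 8 := min_le_right _ _
  rw [M.simple_eq_val]
  refine M.val_le_val hsymm hmono fun s => ?_
  rw [← ENNReal.ofReal_le_ofReal_iff (d.tail_nonneg s), g.ofReal_tail_tuple_eq_superlevel]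
  refine le_trans ?_ (h s)
  have hs : s - η + η / 2 = s - η / 2 := by ring
  rcases hgap (s - η) with h1 | h1 | h1
  · rw [hs] at h1
    have : superlevel g.toFun s = ∅ := by
      rw [eq_empty_iff_forall_notMem]
      rintro u ⟨hu, hgu⟩
      have h2 : ∀ v ∈ Ico (0 : ℝ) 1, f v ≤ s - η / 2 := by
        intro v hv
        by_contra! hcon
        exact (eq_empty_iff_forall_notMem.mp h1) v ⟨hv, hcon⟩
      have := toFun_le_of_mem_nhdSimple hε hg h2 hu
      linarith
    rw [this, measure_empty]
    exact zero_le
  · rw [superlevel_eq_Ico h1]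
    exact measure_mono fun u hu => hu.1
  · rw [hs] at h1
    have hsub : superlevel g.toFun s ⊆ superlevel f (s - η / 2) ∪
        {u | u ∈ Ico (0 : ℝ) 1 ∧ η / 2 ≤ |f u - g.toFun u|} := by
      rintro u ⟨hu, hgu⟩
      rcases lt_or_ge (s - η / 2) (f u) with h2 | h2
      · exact Or.inl ⟨hu, h2⟩
      · exact Or.inr ⟨hu, le_trans (by linarith) (neg_le_abs _)⟩
    refine le_trans ?_ h1
    refine (measure_mono hsub).trans ((measure_union_le _ _).trans (add_le_add_right ?_ _))
    refine (volume_le_abs_sub_le hf.measurable (half_pos hη) hg).trans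
      (ENNReal.ofReal_le_ofReal ?_)
    rwa [div_le_iff₀ (half_pos hη)]

end Gap

/-! ### Lower and upper envelopes -/

namespace WeightedMean

variable (M : WeightedMean K I)

/-- The supremum of the means of the tuples that lie below `f` in distribution with a margin. -/
noncomputable def lowerEnvelope (f : ℝ → ℝ) : EReal :=
  sSup {z | ∃ (d : WeightedTuple K I) (η : ℝ), 0 < η ∧
    (∀ s, ENNReal.ofReal (d.tail s) ≤ volume (superlevel f (s + η))) ∧ z = M.val d}

/-- The infimum of the means of the tuples that lie above `f` in distribution with a margin. -/
noncomputable def upperEnvelope (f : ℝ → ℝ) : EReal :=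
  sInf {z | ∃ (d : WeightedTuple K I) (η : ℝ), 0 < η ∧
    (∀ s, volume (superlevel f (s - η)) ≤ ENNReal.ofReal (d.tail s)) ∧ z = M.val d}

variable {f₁ f₂ : ℝ → ℝ}

theorem lowerEnvelope_mono (h : ∀ u ∈ Ico (0 : ℝ) 1, f₁ u ≤ f₂ u) :
    M.lowerEnvelope f₁ ≤ M.lowerEnvelope f₂ := by
  refine sSup_le_sSup ?_
  rintro z ⟨d, η, hη, hd, rfl⟩
  exact ⟨d, η, hη, fun s => (hd s).trans (measure_mono (superlevel_mono
    fun u hu hs => hs.trans_le (h u hu))), rfl⟩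

theorem upperEnvelope_mono (h : ∀ u ∈ Ico (0 : ℝ) 1, f₁ u ≤ f₂ u) :
    M.upperEnvelope f₁ ≤ M.upperEnvelope f₂ := by
  refine sInf_le_sInf ?_
  rintro z ⟨d, η, hη, hd, rfl⟩
  exact ⟨d, η, hη, fun s => (measure_mono (superlevel_mono
    fun u hu hs => hs.trans_le (h u hu))).trans (hd s), rfl⟩

/-- A simple function close to the midpoint of f₁ and f₂ lies above the one and below the other with
a margin, so its mean separates the two envelopes. -/
theorem upperEnvelope_le_lowerEnvelope (hI : I.OrdConnected) (hf₁ : Continuous f₁)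
    (hf₂ : Continuous f₂) (h₁ : MapsTo f₁ (Ico 0 1) I) (h₂ : MapsTo f₂ (Ico 0 1) I) {η : ℝ}
    (hη : 0 < η) (h : ∀ u ∈ Ico (0 : ℝ) 1, f₁ u + η ≤ f₂ u) :
    M.upperEnvelope f₁ ≤ M.lowerEnvelope f₂ := by
  obtain ⟨g, hg⟩ := exists_simpleFn_near (K := K) (I := I) (φ := fun u => (f₁ u + f₂ u) / 2)
    (by fun_prop) (fun u hu => hI.out (h₁ hu) (h₂ hu)
      ⟨by linarith [h u hu], by linarith [h u hu]⟩) (show 0 < η / 4 by positivity)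
  have hη8 : 0 < η / 8 := by positivity
  refine le_trans (sInf_le ⟨g.tuple, η / 8, hη8, fun s => ?_, rfl⟩)
    (le_sSup ⟨g.tuple, η / 8, hη8, fun s => ?_, rfl⟩) <;>
  rw [g.ofReal_tail_tuple_eq_superlevel] <;>
  refine measure_mono (superlevel_mono fun u hu hs => ?_) <;>
  have h1 := abs_le.mp (hg u hu).2 <;>
  have h2 := h u hu <;>
  linarith [h1.1, h1.2]

variable {M}

theorem lowerEnvelope_le_lower (hsymm : M.IsSymmetric) (hmono : M.IsMonotone) {t : ℝ}
    {f : ℝ → ℝ} (hf : Continuous (rescale 0 t f)) (hfa : Antitone (rescale 0 t f)) :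
    M.lowerEnvelope (rescale 0 t f) ≤ M.lower 0 t f := by
  refine sSup_le ?_
  rintro z ⟨d, η, hη, hd, rfl⟩
  obtain ⟨ε, hε, h⟩ := exists_val_le_simple hsymm hmono hf hfa hη hd
  exact le_iSup_of_le ⟨ε, hε⟩ (le_iInf₂ fun g hg => EReal.coe_le_coe_iff.mpr (h g hg))

theorem upper_le_upperEnvelope (hsymm : M.IsSymmetric) (hmono : M.IsMonotone) {t : ℝ}
    {f : ℝ → ℝ} (hf : Continuous (rescale 0 t f)) (hfa : Antitone (rescale 0 t f)) :
    M.upper 0 t f ≤ M.upperEnvelope (rescale 0 t f) := by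
  refine le_sInf ?_
  rintro z ⟨d, η, hη, hd, rfl⟩
  obtain ⟨ε, hε, h⟩ := exists_simple_le_val hsymm hmono hf hfa hη hd
  exact iInf_le_of_le ⟨ε, hε⟩ (iSup₂_le fun g hg => EReal.coe_le_coe_iff.mpr (h g hg))

end WeightedMean

/-! ### Generic multiples have a well-defined mean -/

section Generic

variable {M : WeightedMean K I} {F : ℝ → ℝ} {c : ℝ}

theorem rescale_zero_left (t : ℝ) (f : ℝ → ℝ) : rescale 0 t f = fun u => f (u * t) := by
  funext u
  simp [rescale]

/-- On [0,t) the gap between the two multiples is at least (r' - r) F(t) > 0. -/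
theorem upperEnvelope_le_lowerEnvelope_of_lt (hF : Continuous F) (hFa : Antitone F)
    (hF0 : ∀ t, 0 < F t) (hc : c ∈ I) (hFc : ∀ t, F t ≤ c) (hI : I.OrdConnected)
    (hI0 : IsGLB I 0) {r r' : ℝ} (hr : 0 < r) (hrr' : r < r') (hr' : r' ≤ 1) {t : ℝ} (ht : 0 < t) :
    M.upperEnvelope (fun u => r * F (u * t)) ≤ M.lowerEnvelope (fun u => r' * F (u * t)) := by
  have hmem : ∀ ρ, 0 < ρ → ρ ≤ 1 → ∀ u, ρ * F u ∈ I := fun ρ h0 h1 u =>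
    mem_of_pos_of_le hI hI0 hc (mul_pos h0 (hF0 u))
      (by nlinarith [hF0 u, hFc u])
  have hr'0 := hr.trans hrr'
  refine M.upperEnvelope_le_lowerEnvelope hI (by fun_prop) (by fun_prop)
    (fun u _ => hmem r hr (by linarith) _) (fun u _ => hmem r' hr'0 hr' _)
    (mul_pos (sub_pos.mpr hrr') (hF0 t)) fun u hu => ?_
  have h1 : F t ≤ F (u * t) := hFa (by nlinarith [hu.2])
  nlinarith

/-- Almost all multiples of a positive decreasing continuous function have a well-defined mean on
almost all initial intervals. -/
theorem exists_extDefined (hF : Continuous F) (hFa : Antitone F) (hF0 : ∀ t, 0 < F t)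
    (hc : c ∈ I) (hFc : ∀ t, F t ≤ c) (hI : I.OrdConnected) (hI0 : IsGLB I 0)
    (hsymm : M.IsSymmetric) (hmono : M.IsMonotone) (hFi : IntegrableOn F (Ici 0)) {r₀ : ℝ}
    (hr₀ : 0 ≤ r₀) (hr₀1 : r₀ < 1) :
    ∃ r ∈ Ioo r₀ 1, ∀ᵐ t ∂(volume.restrict (Ioi (0 : ℝ))), M.ExtDefined 0 t fun x => r * F x := by
  set L : ℝ → ℝ → EReal := fun r t => M.lowerEnvelope fun u => r * F (u * t) with hL
  set U : ℝ → ℝ → EReal := fun r t => M.upperEnvelope fun u => r * F (u * t) with hU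
  have hLr : ∀ t, Monotone fun r => L r t := fun t r r' h =>
    M.lowerEnvelope_mono fun u _ => mul_le_mul_of_nonneg_right h (hF0 _).le
  -- Only rational lengths are considered here, so that the exceptional multipliers remain countable
  -- in all. Monotonicity in the length later carries the result to almost every t.
  have hbad : (⋃ q : ℚ, {r | ¬ContinuousAt (fun r => L r q) r}).Countable :=
    countable_iUnion fun q => (hLr q).countable_not_continuousAt
  obtain ⟨r, hr, hrI⟩ := (hbad.dense_compl ℝ).exists_mem_open isOpen_Ioo
    (nonempty_Ioo.mpr hr₀1)
  refine ⟨r, hrI, ?_⟩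
  have hrpos : 0 < r := hr₀.trans_lt hrI.1
  have hcont : ∀ q : ℚ, ContinuousAt (fun r => L r q) r := by
    intro q
    by_contra hcon
    exact hr (mem_iUnion.mpr ⟨q, hcon⟩)
  have hrat : ∀ q : ℚ, (0 : ℝ) < q → U r q ≤ L r q := by
    intro q hq
    refine ge_of_tendsto ((hcont q).tendsto.mono_left
      (nhdsWithin_le_nhds : nhdsWithin r (Ioi r) ≤ nhds r)) ?_
    filter_upwards [Ioo_mem_nhdsGT hrI.2] with r' hr'
    exact upperEnvelope_le_lowerEnvelope_of_lt hF hFa hF0 hc hFc hI hI0 hrpos hr'.1 hr'.2.le hq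
  have hLt : Antitone (L r) := fun t t' h => M.lowerEnvelope_mono fun u hu =>
    mul_le_mul_of_nonneg_left (hFa (mul_le_mul_of_nonneg_left h hu.1)) hrpos.le
  have hUt : Antitone (U r) := fun t t' h => M.upperEnvelope_mono fun u hu =>
    mul_le_mul_of_nonneg_left (hFa (mul_le_mul_of_nonneg_left h hu.1)) hrpos.le
  have hmem : MapsTo (fun x => r * F x) (Ici 0) I := fun x _ =>
    mem_of_pos_of_le hI hI0 hc (mul_pos hrpos (hF0 x)) (by nlinarith [hF0 x, hFc x, hrI.2])
  filter_upwards [hLt.countable_not_continuousAt.ae_notMem (volume.restrict (Ioi (0 : ℝ))),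
    ae_restrict_mem measurableSet_Ioi] with t ht ht0
  have hcontt : ContinuousAt (L r) t := by simpa using ht
  have ht0' : 0 < t := ht0
  have hUL : U r t ≤ L r t := by
    -- For t' < q < t with q rational, U(t) ≤ U(q) ≤ L(q) ≤ L(t'), and L(t') tends to L(t) as t'
    -- increases to t.
    refine ge_of_tendsto (hcontt.tendsto.mono_left
      (nhdsWithin_le_nhds : nhdsWithin t (Iio t) ≤ nhds t)) ?_
    filter_upwards [Ioo_mem_nhdsLT ht0'] with t' ht'
    obtain ⟨q, hq1, hq2⟩ := exists_rat_btwn ht'.2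
    exact (hUt hq2.le).trans ((hrat q (ht'.1.trans hq1)).trans (hLt hq1.le))
  have hresc : rescale 0 t (fun x => r * F x) = fun u => r * F (u * t) := rescale_zero_left _ _
  have hrc : Continuous (rescale 0 t fun x => r * F x) := by
    rw [hresc]
    fun_prop
  have hra : Antitone (rescale 0 t fun x => r * F x) := by
    rw [hresc]
    exact fun u v h => mul_le_mul_of_nonneg_left (hFa (mul_le_mul_of_nonneg_right h ht0'.le))
      hrpos.le
  refine le_antisymm (M.lower_le_upper hI (hFi.const_mul r) hmem ht0') ?_
  refine (WeightedMean.upper_le_upperEnvelope hsymm hmono hrc hra).trans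
    (le_trans ?_ (WeightedMean.lowerEnvelope_le_lower hsymm hmono hrc hra))
  rw [hresc]
  exact hUL

end Generic

/-! ### A continuous majorant of a step function -/

/-- The continuous descent from `1` at `0` to `0` at `1`. -/
noncomputable def ramp (z : ℝ) : ℝ := max 0 (min 1 (1 - z))

theorem continuous_ramp : Continuous ramp := by unfold ramp; fun_prop

theorem ramp_antitone : Antitone ramp := fun a b h =>
  max_le_max le_rfl (min_le_min le_rfl (by linarith))

theorem ramp_nonneg (z : ℝ) : 0 ≤ ramp z := le_max_left _ _

theorem ramp_le_one (z : ℝ) : ramp z ≤ 1 := max_le zero_le_one (min_le_left _ _)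

theorem ramp_of_nonpos {z : ℝ} (h : z ≤ 0) : ramp z = 1 := by
  rw [ramp, min_eq_left (by linarith), max_eq_right zero_le_one]

theorem ramp_of_one_le {z : ℝ} (h : 1 ≤ z) : ramp z = 0 := by
  rw [ramp, min_eq_right (by linarith), max_eq_left (by linarith)]

/-- A continuous version of the decreasing rearrangement of the step function with values `y i` on
intervals of length `w i`. -/
noncomputable def smoothRearrangement {n : ℕ} (y w : Fin (n + 1) → ℝ) (δ v : ℝ) : ℝ :=
  Finset.univ.sup' Finset.univ_nonempty fun i => y i * ramp ((v - levelSum y w i) / δ)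

section smoothRearrangement

variable {n : ℕ} {y w : Fin (n + 1) → ℝ} {δ c : ℝ}

theorem continuous_smoothRearrangement : Continuous (smoothRearrangement y w δ) := by
  have h : ∀ i, Continuous fun v => y i * ramp ((v - levelSum y w i) / δ) := fun i =>
    continuous_const.mul (continuous_ramp.comp (by fun_prop))
  exact Continuous.finset_sup'_apply _ fun i _ => h i

theorem smoothRearrangement_antitone (hy : ∀ i, 0 ≤ y i) (hδ : 0 < δ) :
    Antitone (smoothRearrangement y w δ) := by
  intro a b h
  refine Finset.sup'_mono_fun fun i _ => mul_le_mul_of_nonneg_left (ramp_antitone ?_) (hy i)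
  gcongr

theorem smoothRearrangement_le (hy : ∀ i, 0 ≤ y i) (hyc : ∀ i, y i ≤ c) (v : ℝ) :
    smoothRearrangement y w δ v ≤ c :=
  Finset.sup'_le _ _ fun i _ => (mul_le_of_le_one_right (hy i) (ramp_le_one _)).trans (hyc i)

theorem smoothRearrangement_nonneg (hy : ∀ i, 0 ≤ y i) (v : ℝ) :
    0 ≤ smoothRearrangement y w δ v :=
  (mul_nonneg (hy 0) (ramp_nonneg _)).trans
    (Finset.le_sup' (fun i => y i * ramp ((v - levelSum y w i) / δ)) (Finset.mem_univ 0))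

theorem le_smoothRearrangement (hδ : 0 < δ) {i : Fin (n + 1)} {v : ℝ} (h : v ≤ levelSum y w i) :
    y i ≤ smoothRearrangement y w δ v := by
  have h1 : y i * ramp ((v - levelSum y w i) / δ) = y i := by
    rw [ramp_of_nonpos (div_nonpos_of_nonpos_of_nonneg (by linarith) hδ.le), mul_one]
  rw [← h1]
  exact Finset.le_sup' (fun i => y i * ramp ((v - levelSum y w i) / δ)) (Finset.mem_univ i)

/-- The ramps lengthen each super-level set by at most δ, and only levels below c occur. -/
theorem lintegral_smoothRearrangement_le (hy : ∀ i, 0 ≤ y i) (hyc : ∀ i, y i ≤ c)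
    (hw : ∀ i, 0 ≤ w i) (hδ : 0 < δ) :
    ∫⁻ v in Ioi (0 : ℝ), ENNReal.ofReal (smoothRearrangement y w δ v) ≤
      (∑ i, ENNReal.ofReal (w i * y i)) + ENNReal.ofReal δ * ENNReal.ofReal c := by
  rw [lintegral_eq_lintegral_meas_lt (volume.restrict (Ioi (0 : ℝ)))
    (Filter.Eventually.of_forall (smoothRearrangement_nonneg hy))
    continuous_smoothRearrangement.aemeasurable]
  calc ∫⁻ s in Ioi (0 : ℝ), volume.restrict (Ioi (0 : ℝ)) {v | s < smoothRearrangement y w δ v}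
      ≤ ∫⁻ s in Ioi (0 : ℝ), (ENNReal.ofReal (tailSum y w s) +
          (Iio c).indicator (fun _ => ENNReal.ofReal δ) s) := by
        refine setLIntegral_mono' measurableSet_Ioi fun s hs => ?_
        rw [Measure.restrict_apply' measurableSet_Ioi]
        have hs0 : 0 < s := hs
        by_cases hsc : s < c
        · rw [indicator_of_mem (show s ∈ Iio c from hsc),
            ← ENNReal.ofReal_add (tailSum_nonneg hw s) hδ.le]
          have hsub : {v | s < smoothRearrangement y w δ v} ∩ Ioi 0 ⊆
              Ioo 0 (tailSum y w s + δ) := by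
            rintro v ⟨hv, hv0⟩
            refine ⟨hv0, ?_⟩
            obtain ⟨i, -, hi⟩ := (Finset.lt_sup'_iff _).mp
              (show s < Finset.univ.sup' Finset.univ_nonempty _ from hv)
            have hyi : s < y i := hi.trans_le (mul_le_of_le_one_right (hy i) (ramp_le_one _))
            have hvi : (v - levelSum y w i) / δ < 1 := by
              by_contra! hcon
              rw [ramp_of_one_le hcon, mul_zero] at hi
              linarith
            rw [div_lt_one hδ] at hvi
            linarith [levelSum_le_tailSum hw hyi]
          refine (measure_mono hsub).trans_eq ?_
          rw [Real.volume_Ioo, sub_zero]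
        · have : {v | s < smoothRearrangement y w δ v} = ∅ := by
            rw [eq_empty_iff_forall_notMem]
            exact fun v hv => hsc (lt_of_lt_of_le hv (smoothRearrangement_le hy hyc v))
          rw [this, empty_inter, measure_empty]
          exact zero_le
    _ = _ := by
        rw [lintegral_add_right _ (measurable_const.indicator measurableSet_Iio),
          lintegral_ofReal_tailSum hw, lintegral_indicator measurableSet_Iio, setLIntegral_const,
          Measure.restrict_apply measurableSet_Iio, inter_comm, Ioi_inter_Iio, Real.volume_Ioo,
          sub_zero]

end smoothRearrangement

theorem lintegral_exp_neg (κ : ℝ) (hκ : 0 ≤ κ) :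
    ∫⁻ v in Ioi (0 : ℝ), ENNReal.ofReal (κ * Real.exp (-max v 0)) = ENNReal.ofReal κ := by
  have h1 : ∫⁻ v in Ioi (0 : ℝ), ENNReal.ofReal (κ * Real.exp (-max v 0)) =
      ∫⁻ v in Ioi (0 : ℝ), ENNReal.ofReal (κ * Real.exp (-v)) := by
    refine setLIntegral_congr_fun measurableSet_Ioi fun v hv => ?_
    simp only [max_eq_left (le_of_lt (show (0 : ℝ) < v from hv))]
  rw [h1, ← ofReal_integral_eq_lintegral_ofReal ((integrableOn_exp_neg_Ioi 0).const_mul κ)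
    (Filter.Eventually.of_forall fun v => by positivity), integral_const_mul,
    integral_exp_neg_Ioi_zero, mul_one]

/-- A positive decreasing continuous function that exceeds the decreasing rearrangement of a step
function, with a margin, and whose integral is hardly larger. -/
theorem exists_continuous_majorant {n : ℕ} {x w : Fin (n + 1) → ℝ} {c θ e : ℝ}
    (hx : ∀ i, 0 < x i) (hxc : ∀ i, x i + θ ≤ c) (hθ : 0 < θ) (hw : ∀ i, 0 ≤ w i) (he : 0 < e) :
    ∃ F : ℝ → ℝ, ∃ η r₀ : ℝ, Continuous F ∧ Antitone F ∧ (∀ t, 0 < F t) ∧ (∀ t, F t ≤ c) ∧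
      0 < η ∧ 0 ≤ r₀ ∧ r₀ < 1 ∧
      ∫⁻ t in Ioi (0 : ℝ), ENNReal.ofReal (F t) ≤
        (∑ i, ENNReal.ofReal (w i * x i)) + ENNReal.ofReal e ∧
      ∀ r ∈ Ioo r₀ 1, ∀ s v, 0 ≤ v → v < tailSum x w s → s + η < r * F v := by
  have hc : 0 < c := by linarith [hx 0, hxc 0]
  have hW : 0 ≤ ∑ i, w i := Finset.sum_nonneg fun i _ => hw i
  set W := ∑ i, w i with hWdef
  -- The error e is shared equally: raising the entries by 2η, the exponential of integral κ, and
  -- the ramps of width δ cost at most e/3 each. Moreover 2η ≤ θ keeps the raised entries below c.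
  set η := min (θ / 2) (e / (6 * (W + 1))) with hη
  have hη0 : 0 < η := by positivity
  have hηθ : 2 * η ≤ θ := by linarith [min_le_left (θ / 2) (e / (6 * (W + 1)))]
  have hηe : W * (2 * η) ≤ e / 3 := by
    have h1 : η * (6 * (W + 1)) ≤ e := by
      rw [← le_div_iff₀ (by positivity)]
      exact min_le_right _ _
    nlinarith
  set κ := min c (e / 3) with hκ
  have hκ0 : 0 < κ := by positivity
  set δ := e / 3 / c with hδ
  have hδ0 : 0 < δ := by positivity
  set y : Fin (n + 1) → ℝ := fun i => x i + 2 * η with hy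
  have hy0 : ∀ i, 0 ≤ y i := fun i => by linarith [hx i]
  have hyc : ∀ i, y i ≤ c := fun i => by linarith [hxc i]
  have hlev : ∀ i, levelSum y w i = levelSum x w i := fun i => by simp [levelSum, hy]
  have hexp : ∀ v : ℝ, Real.exp (-max v 0) ≤ 1 := fun v => by simp
  -- The exponential keeps the function positive everywhere. The ratio (c+η)/(c+2η) is the least
  -- factor for which every x ≤ c satisfies r(x + 2η) ≥ x + η.
  refine ⟨fun v => max (κ * Real.exp (-max v 0)) (smoothRearrangement y w δ v), η,
    (c + η) / (c + 2 * η), ?_, ?_, ?_, ?_, hη0, by positivity, ?_, ?_, ?_⟩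
  · exact Continuous.max (by fun_prop) continuous_smoothRearrangement
  · intro a b h
    refine max_le_max ?_ (smoothRearrangement_antitone hy0 hδ0 h)
    gcongr
  · exact fun v => lt_max_of_lt_left (by positivity)
  · exact fun v => max_le ((mul_le_of_le_one_right hκ0.le (hexp v)).trans (min_le_left _ _))
      (smoothRearrangement_le hy0 hyc v)
  · rw [div_lt_one (by positivity)]
    linarith
  · calc ∫⁻ v in Ioi (0 : ℝ),
          ENNReal.ofReal (max (κ * Real.exp (-max v 0)) (smoothRearrangement y w δ v))
        ≤ ∫⁻ v in Ioi (0 : ℝ), (ENNReal.ofReal (κ * Real.exp (-max v 0)) +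
            ENNReal.ofReal (smoothRearrangement y w δ v)) := by
          refine lintegral_mono fun v => ?_
          rw [ENNReal.ofReal_max]
          exact max_le le_self_add le_add_self
      _ ≤ ENNReal.ofReal κ + ((∑ i, ENNReal.ofReal (w i * y i)) +
            ENNReal.ofReal δ * ENNReal.ofReal c) := by
          rw [lintegral_add_right _ continuous_smoothRearrangement.measurable.ennreal_ofReal,
            lintegral_exp_neg κ hκ0.le]
          exact add_le_add_right (lintegral_smoothRearrangement_le hy0 hyc hw hδ0) _
      _ = (∑ i, ENNReal.ofReal (w i * x i)) +
            (ENNReal.ofReal κ + ENNReal.ofReal (W * (2 * η)) + ENNReal.ofReal (δ * c)) := by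
          have h1 : ∀ i, ENNReal.ofReal (w i * y i) =
              ENNReal.ofReal (w i * x i) + ENNReal.ofReal (w i * (2 * η)) := by
            intro i
            have h2 := hw i
            have h3 := (hx i).le
            rw [← ENNReal.ofReal_add (by positivity) (by positivity), ← mul_add]
          simp only [h1, Finset.sum_add_distrib]
          rw [hWdef, Finset.sum_mul, ENNReal.ofReal_sum_of_nonneg
            (fun i _ => mul_nonneg (hw i) (by positivity)), ENNReal.ofReal_mul hδ0.le]
          ring
      _ ≤ _ := by
          rw [← ENNReal.ofReal_add hκ0.le (by positivity), ← ENNReal.ofReal_add (by positivity)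
            (by positivity)]
          refine add_le_add_right (ENNReal.ofReal_le_ofReal ?_) _
          have h1 : κ ≤ e / 3 := min_le_right _ _
          have h2 : δ * c = e / 3 := div_mul_cancel₀ _ hc.ne'
          linarith
  · intro r hr s v hv0 hv
    obtain ⟨i, hi, hi'⟩ := exists_tailSum_eq_levelSum (hv0.trans_lt hv)
    rw [hi', ← hlev] at hv
    have h1 := (le_smoothRearrangement (y := y) (w := w) hδ0 hv.le).trans
      (le_max_right (κ * Real.exp (-max v 0)) _)
    have hr0 : 0 < r := lt_of_le_of_lt (by positivity) hr.1
    have h2 := mul_le_mul_of_nonneg_left h1 hr0.le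
    have h3 : x i + η ≤ r * y i := by
      have h4 : (c + η) / (c + 2 * η) * y i ≤ r * y i :=
        mul_le_mul_of_nonneg_right hr.1.le (hy0 i)
      refine le_trans ?_ h4
      rw [div_mul_eq_mul_div, le_div_iff₀ (by positivity)]
      have h5 : x i ≤ c := by linarith [hxc i]
      simp only [hy]
      nlinarith
    linarith

/-! ### The discrete inequality from the integral one -/

theorem sum_le_lintegral_of_forall_Ioc {G : ℝ → ℝ≥0∞} {w : ℕ → ℝ} (hw : ∀ n, 0 < w n)
    (a : ℕ → ℝ≥0∞) (N : ℕ)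
    (h : ∀ n < N, ∀ t ∈ Ioc (∑ i ∈ Finset.range n, w i) (∑ i ∈ Finset.range (n + 1), w i),
      a n ≤ G t) :
    ∑ n ∈ Finset.range N, ENNReal.ofReal (w n) * a n ≤
      ∫⁻ t in Ioc 0 (∑ i ∈ Finset.range N, w i), G t := by
  induction N with
  | zero => simp
  | succ N ih =>
    have h0 : 0 ≤ ∑ i ∈ Finset.range N, w i := Finset.sum_nonneg fun i _ => (hw i).le
    have h1 : ∑ i ∈ Finset.range N, w i ≤ ∑ i ∈ Finset.range (N + 1), w i := by
      rw [Finset.sum_range_succ]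
      linarith [hw N]
    rw [Finset.sum_range_succ, ← Ioc_union_Ioc_eq_Ioc h0 h1,
      lintegral_union measurableSet_Ioc (by
        rw [Set.disjoint_left]
        exact fun t ht ht' => absurd ht.2 (not_le.mpr ht'.1))]
    refine add_le_add (ih fun n hn => h n (by omega)) ?_
    calc ENNReal.ofReal (w N) * a N
        = ∫⁻ t in Ioc (∑ i ∈ Finset.range N, w i) (∑ i ∈ Finset.range (N + 1), w i), a N := by
          rw [setLIntegral_const, Real.volume_Ioc, Finset.sum_range_succ, add_sub_cancel_left,
            mul_comm]
      _ ≤ _ := setLIntegral_mono' measurableSet_Ioc fun t ht => h N (by omega) t ht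

/-- The integral Hardy inequality holds with the constant `C` on the domain of the integral
mean. -/
def WeightedMean.IsIntegralHardyBound (M : WeightedMean K I) (C : ℝ≥0∞) : Prop :=
  ∀ f : ℝ → ℝ, MapsTo f (Ici 0) I → IntegrableOn f (Ici 0) →
    (∀ᵐ t ∂(volume.restrict (Ioi (0 : ℝ))), M.ExtDefined 0 t f) →
    ∫⁻ t in Ioi (0 : ℝ), (M.ext 0 t f).toENNReal ≤ C * ∫⁻ t in Ioi (0 : ℝ), ENNReal.ofReal (f t)

section IntegralHardy

variable {M : WeightedMean K I} {C : ℝ≥0∞} {x w : ℕ → ℝ}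

theorem isWeight_initial (hw : ∀ n, w n ∈ K ∧ 0 < w n) (n : ℕ) :
    IsWeight K (fun i : Fin (n + 1) => w i) :=
  ⟨fun i => ⟨(hw i).1, (hw i).2.le⟩, Finset.sum_pos (fun i _ => (hw i).2) ⟨0, Finset.mem_univ _⟩⟩

/-- The integral inequality is tested on a generic multiple rF of the continuous majorant of all N +
1 terms. For t at most the sum of the first n + 1 weights, rF on [0,t) dominates these terms with a
margin, so its lower envelope is at least their mean. -/
theorem sum_le_of_isIntegralHardyBound_of_lt (hI : I.OrdConnected) (hI0 : IsGLB I 0)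
    (hsymm : M.IsSymmetric) (hmono : M.IsMonotone) (hC : M.IsIntegralHardyBound C) (hC' : C ≠ ∞)
    (hx : ∀ n, x n ∈ I ∧ 0 < x n) (hw : ∀ n, w n ∈ K ∧ 0 < w n) (N : ℕ) {c θ : ℝ} (hc : c ∈ I)
    (hθ : 0 < θ) (hxc : ∀ n < N + 1, x n + θ ≤ c) :
    ∑ n ∈ Finset.range (N + 1), ENNReal.ofReal
        (w n * M.toFun (n + 1) (fun i : Fin (n + 1) => x i) (fun i : Fin (n + 1) => w i))
      ≤ C * ∑ n ∈ Finset.range (N + 1), ENNReal.ofReal (w n * x n) := by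
  refine le_of_forall_le_add_mul_one_div hC' fun q => ?_
  obtain ⟨F, η, r₀, hF, hFa, hF0, hFc, hη, hr₀, hr₀1, hFint, hFtail⟩ :=
    exists_continuous_majorant (x := fun i : Fin (N + 1) => x i) (w := fun i : Fin (N + 1) => w i)
      (fun i => (hx i).2) (fun i => hxc i i.2) hθ (fun i => (hw i).2.le)
      (show (0 : ℝ) < 1 / ((q : ℝ) + 1) by positivity)
  have hFint' : ∫⁻ t in Ioi (0 : ℝ), ENNReal.ofReal (F t) ≠ ∞ := by
    refine ne_top_of_le_ne_top ?_ hFint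
    exact ENNReal.add_ne_top.mpr
      ⟨ENNReal.sum_ne_top.mpr fun _ _ => ENNReal.ofReal_ne_top, ENNReal.ofReal_ne_top⟩
  have hFi : IntegrableOn F (Ici 0) := by
    rw [integrableOn_Ici_iff_integrableOn_Ioi]
    refine ⟨hF.aestronglyMeasurable, ?_⟩
    rw [hasFiniteIntegral_iff_ofReal (Filter.Eventually.of_forall fun t => (hF0 t).le)]
    exact hFint'.lt_top
  obtain ⟨r, hr, hext⟩ := exists_extDefined hF hFa hF0 hc hFc hI hI0 hsymm hmono hFi hr₀ hr₀1
  have hr0 : 0 < r := hr₀.trans_lt hr.1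
  have hmem : MapsTo (fun t => r * F t) (Ici 0) I := fun t _ =>
    mem_of_pos_of_le hI hI0 hc (mul_pos hr0 (hF0 t)) (by nlinarith [hF0 t, hFc t, hr.2])
  have hmain := hC (fun t => r * F t) hmem (hFi.const_mul r) hext
  have hupper : ∫⁻ t in Ioi (0 : ℝ), ENNReal.ofReal (r * F t) ≤
      (∑ n ∈ Finset.range (N + 1), ENNReal.ofReal (w n * x n)) +
        ENNReal.ofReal (1 / ((q : ℝ) + 1)) := by
    rw [Finset.sum_range]
    refine le_trans (lintegral_mono fun t => ENNReal.ofReal_le_ofReal ?_) hFint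
    exact mul_le_of_le_one_left (hF0 t).le hr.2.le
  have hlower : ∑ n ∈ Finset.range (N + 1), ENNReal.ofReal
        (w n * M.toFun (n + 1) (fun i : Fin (n + 1) => x i) (fun i : Fin (n + 1) => w i)) ≤
      ∫⁻ t in Ioi (0 : ℝ), (M.ext 0 t fun t => r * F t).toENNReal := by
    simp only [ENNReal.ofReal_mul (hw _).2.le]
    refine (sum_le_lintegral_of_forall_Ioc (G := fun t => (M.ext 0 t fun t => r * F t).toENNReal)
      (fun n => (hw n).2) _ (N + 1) fun n hn t ht => ?_).trans
      (lintegral_mono_set Ioc_subset_Ioi_self)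
    have hwn := isWeight_initial hw n
    have hWn : ∑ i ∈ Finset.range (n + 1), w i = ∑ i : Fin (n + 1), w i := Finset.sum_range _
    rw [hWn] at ht
    have ht0 : 0 < t := lt_of_le_of_lt (Finset.sum_nonneg fun i _ => (hw i).2.le) ht.1
    have hresc : rescale 0 t (fun x => r * F x) = fun u => r * F (u * t) := rescale_zero_left _ _
    have hrc : Continuous (rescale 0 t fun x => r * F x) := by
      rw [hresc]
      fun_prop
    have hra : Antitone (rescale 0 t fun x => r * F x) := by
      rw [hresc]
      exact fun u v h => mul_le_mul_of_nonneg_left (hFa (mul_le_mul_of_nonneg_right h ht0.le))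
        hr0.le
    have hle : (M.toFun (n + 1) (fun i : Fin (n + 1) => x i) (fun i : Fin (n + 1) => w i) : EReal)
        ≤ M.ext 0 t fun t => r * F t := by
      refine le_trans ?_ (WeightedMean.lowerEnvelope_le_lower hsymm hmono hrc hra)
      rw [← M.val_normalize _ _ (fun i : Fin (n + 1) => (hx i).1) hwn]
      refine le_sSup ⟨_, η, hη, fun s => ?_, rfl⟩
      set b := (WeightedTuple.normalize _ _ (fun i : Fin (n + 1) => (hx i).1) hwn).tail s with hb
      have hb1 : b ≤ 1 := WeightedTuple.tail_le_one _ s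
      -- For u < b the point ut lies below the unnormalized tail of the first n + 1 terms, because t
      -- is at most their total weight; the tail of all N + 1 terms is larger still.
      have hsub : Ico 0 b ⊆ superlevel (rescale 0 t fun x => r * F x) (s + η) := by
        rintro u ⟨hu0, hub⟩
        refine ⟨⟨hu0, hub.trans_le hb1⟩, ?_⟩
        rw [hresc]
        refine hFtail r hr s (u * t) (by positivity) ?_
        have h1 : tailSum (fun i : Fin (n + 1) => x i) (fun i : Fin (n + 1) => w i) s ≤
            tailSum (fun i : Fin (N + 1) => x i) (fun i : Fin (N + 1) => w i) s := by
          rw [tailSum, tailSum, ← Finset.sum_range (fun i => if s < x i then w i else 0),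
            ← Finset.sum_range (fun i => if s < x i then w i else 0)]
          refine Finset.sum_le_sum_of_subset_of_nonneg
            (Finset.range_subset_range.mpr (by omega)) fun i _ _ => ?_
          split_ifs
          · exact (hw i).2.le
          · rfl
        refine lt_of_lt_of_le ?_ h1
        rw [hb, WeightedTuple.tail_normalize, lt_inv_mul_iff₀ hwn.2] at hub
        refine lt_of_le_of_lt ?_ hub
        rw [mul_comm]
        exact mul_le_mul_of_nonneg_right ht.2 hu0
      refine le_trans ?_ (measure_mono hsub)
      rw [Real.volume_Ico, sub_zero]
    simpa using EReal.toENNReal_le_toENNReal hle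
  rw [← mul_add]
  exact hlower.trans (hmain.trans (mul_le_mul_right hupper C))

/-- Without a greatest element of I, some c in I lies above the finitely many terms. With a greatest
element b the terms are truncated below b, and continuity in the entries recovers the original means
in the limit. -/
theorem sum_le_of_isIntegralHardyBound (hI : I.OrdConnected) (hI0 : IsGLB I 0)
    (hsymm : M.IsSymmetric) (hmono : M.IsMonotone)
    (hmax : ∀ b : ℝ, IsGreatest I b → M.IsContinuousInEntries)
    (hC : M.IsIntegralHardyBound C) (hC' : C ≠ ∞)
    (hx : ∀ n, x n ∈ I ∧ 0 < x n) (hw : ∀ n, w n ∈ K ∧ 0 < w n) (N : ℕ) :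
    ∑ n ∈ Finset.range (N + 1), ENNReal.ofReal
        (w n * M.toFun (n + 1) (fun i : Fin (n + 1) => x i) (fun i : Fin (n + 1) => w i))
      ≤ C * ∑ n ∈ Finset.range (N + 1), ENNReal.ofReal (w n * x n) := by
  by_cases hb : ∃ b, IsGreatest I b
  · obtain ⟨b, hb⟩ := hb
    have hb0 : 0 < b := (hx 0).2.trans_le (hb.2 (hx 0).1)
    -- The shift to q + 1 makes the first truncation level b/2 instead of 0, so that the truncated
    -- terms stay positive.
    set β : ℕ → ℝ := fun q => b - b * (1 / (((q + 1 : ℕ) : ℝ) + 1)) with hβ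
    have hq : ∀ q : ℕ, 0 < 1 / (((q + 1 : ℕ) : ℝ) + 1) ∧ 1 / (((q + 1 : ℕ) : ℝ) + 1) < 1 := by
      intro q
      refine ⟨by positivity, ?_⟩
      rw [div_lt_one (by positivity)]
      push_cast
      linarith [q.cast_nonneg (α := ℝ)]
    have hβ0 : ∀ q, 0 < β q := fun q => by
      have := hq q
      simp only [hβ]
      nlinarith
    have hβb : Filter.Tendsto β Filter.atTop (nhds b) := by
      have h1 := (Filter.tendsto_add_atTop_iff_nat 1).mpr
        (tendsto_one_div_add_atTop_nhds_zero_nat (𝕜 := ℝ))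
      simpa [hβ] using (h1.const_mul b).const_sub b
    set X : ℕ → ℕ → ℝ := fun q n => min (x n) (β q) with hX
    have hXpos : ∀ q n, 0 < X q n := fun q n => lt_min (hx n).2 (hβ0 q)
    have hXI : ∀ q n, X q n ∈ I := fun q n =>
      mem_of_pos_of_le hI hI0 (hx n).1 (hXpos q n) (min_le_left _ _)
    have hXx : ∀ n, Filter.Tendsto (fun q => X q n) Filter.atTop (nhds (x n)) := fun n => by
      have := (tendsto_const_nhds (x := x n)).min hβb
      rwa [min_eq_left (hb.2 (hx n).1)] at this
    have hle : ∀ q, ∑ n ∈ Finset.range (N + 1), ENNReal.ofReal (w n * M.toFun (n + 1)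
        (fun i : Fin (n + 1) => X q i) (fun i : Fin (n + 1) => w i))
        ≤ C * ∑ n ∈ Finset.range (N + 1), ENNReal.ofReal (w n * x n) := by
      intro q
      refine (sum_le_of_isIntegralHardyBound_of_lt hI hI0 hsymm hmono hC hC'
        (fun n => ⟨hXI q n, hXpos q n⟩) hw N hb.1 (mul_pos hb0 (hq q).1) fun n _ => ?_).trans ?_
      · have : X q n ≤ β q := min_le_right _ _
        simp only [hβ] at this
        linarith
      · gcongr with n
        · exact (hw n).2.le
        · exact min_le_left _ _
    refine le_of_tendsto' (x := Filter.atTop) (tendsto_finsetSum _ fun n _ => ?_) hle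
    refine ENNReal.tendsto_ofReal (Filter.Tendsto.const_mul _ ?_)
    have hcont := hmax b hb (n + 1) _ (isWeight_initial hw n) (fun i : Fin (n + 1) => x i)
      (fun i => (hx i).1)
    refine hcont.tendsto.comp (tendsto_nhdsWithin_iff.mpr ⟨?_, ?_⟩)
    · exact tendsto_pi_nhds.mpr fun i => hXx i
    · exact Filter.Eventually.of_forall fun q i => hXI q i
  · obtain ⟨j, -, hj⟩ := Finset.exists_max_image (Finset.range (N + 1)) x ⟨0, by simp⟩
    have : ∃ c ∈ I, x j < c := by
      by_contra! hcon
      exact hb ⟨x j, (hx j).1, hcon⟩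
    obtain ⟨c, hc, hjc⟩ := this
    refine sum_le_of_isIntegralHardyBound_of_lt hI hI0 hsymm hmono hC hC' hx hw N hc
      (sub_pos.mpr hjc) fun n hn => ?_
    linarith [hj n (Finset.mem_range.mpr hn)]

end IntegralHardy

/-- The integral Hardy inequality entails the Hardy inequality. -/
theorem hardyConst_le_integralHardyConstOn {M : WeightedMean K I} (hI : I.OrdConnected)
    (hI0 : IsGLB I 0) (hsymm : M.IsSymmetric) (hmono : M.IsMonotone)
    (hmax : ∀ b : ℝ, IsGreatest I b → M.IsContinuousInEntries) :
    M.hardyConst ≤ integralHardyConstOn I M.ExtDefined M.ext := by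
  refine le_sInf fun C hC => ?_
  by_cases hC' : C = ∞
  · rw [hC']
    exact le_top
  refine sInf_le fun x w hx hw => ?_
  rw [ENNReal.tsum_eq_iSup_nat]
  refine iSup_le fun N => ?_
  refine (Finset.sum_le_sum_of_subset (Finset.range_subset_range.mpr N.le_succ)).trans
    ((sum_le_of_isIntegralHardyBound hI hI0 hsymm hmono hmax hC hC' hx hw N).trans ?_)
  gcongr
  exact ENNReal.sum_le_tsum _

end HardyMeans

theorem mainTheorem1 (K : Subfield ℝ) (I : Set ℝ) (hI : I.OrdConnected) (hI0 : IsGLB I 0)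
    (M : HardyMeans.WeightedMean K I) (hsymm : M.IsSymmetric) (hmono : M.IsMonotone)
    (hmax : ∀ b : ℝ, IsGreatest I b → M.IsContinuousInEntries) :
    HardyMeans.integralHardyConst I M.lower = M.hardyConst ∧
    HardyMeans.integralHardyConst I M.upper = M.hardyConst ∧
    HardyMeans.integralHardyConstOn I M.ExtDefined M.ext = M.hardyConst := by
  have h1 := HardyMeans.hardyConst_le_integralHardyConstOn hI hI0 hsymm hmono hmax
  have h2 := HardyMeans.integralHardyConstOn_ext_le_lower (M := M)
  have h3 := HardyMeans.integralHardyConst_lower_le_upper (M := M) hI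
  have h4 := HardyMeans.integralHardyConst_upper_le hI hI0 hsymm hmono
  exact ⟨le_antisymm (h3.trans h4) (h1.trans h2), le_antisymm h4 ((h1.trans h2).trans h3),
    le_antisymm ((h2.trans h3).trans h4) h1⟩
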